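/- Let $f$ be a meromorphic function on $\mathbb{C}$. Put $B=\bigcup_{n\ge1}f^{-n}(\infty)\subset\mathbb{C}$ (the points whose orbit reaches a pole), and let the Fatou set $F(f)$ be the region of normality of the iterates $f^n$ on $\mathbb{C}\setminus\overline{B}$. Let $p\ge1$ and let $a\in\mathbb{C}\setminus B$ be a fixed point of $f^p$ with multiplier $\lambda:=(f^p)'(a)\in(\mathbb{D}\setminus\{0\})\cup\{1\}$, where $\mathbb{D}$ is the open unit disk. Let $$\Omega:=\Bigl\{z\in F(f):\lim_{n\to\infty}f^{pn+j}(z)=a\text{ for some }j\ge0\Bigr\}$$ be the attracting (if $|\lambda|<1$) or parabolic (if $\lambda=1$) basin associated to $a$. Let $\Phi:\Omega\to\mathbb{C}$ be holomorphic such that - if $0<|\lambda|<1$ (Schröder equation): $\Phi\circ f=\lambda^{1/p}\,\Phi$ on $\Omega$ for some fixed $p$-th root $\lambda^{1/p}$ of $\lambda$, and $\Phi'(f^j(a))\ne0$ for $0\le j\le p-1$; - if $\lambda=1$ (Abel equation): $\Phi\circ f=\Phi+\frac1p$ on $\Omega$, and $\Phi$ is injective on every attracting petal of $f^p$ at each point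 $f^j(a)$, $0\le j\le p-1$. Here an attracting petal of $f^p$ at $\zeta$ for an attracting direction $u$ is an open set $P\subset\mathbb{C}\setminus B$ which $f^p$ maps univalently into itself and such that an orbit under $f^p$ is eventually absorbed by $P$ if and only if it converges to $\zeta$ from the direction $u$. A unit vector $u$ is an attracting direction at $\zeta$ if $f^p(z)=z+b(z-\zeta)^{k+1}+o((z-\zeta)^{k+1})$ near $\zeta$ with $k\ge1$ and $bu^k$ a negative real number, and $(z_n)$ converges to $\zeta$ from the direction $u$ if $z_n\to\zeta$ and $(z_n-\zeta)/|z_n-\zeta|\to u$. Then for every integer $t\ge2$, as $n\to\infty$, $$\frac{(f^n)^{(t)}}{(f^n)'}=\frac{\Phi^{(t)}}{\Phi'}+\begin{cases}O\bigl(|\lambda|^{n/p}\bigr)&\text{if }0<|\lambda|<1,\\ O(1/n)&\text{if }\lambda=1,\end{cases}$$ locally uniformly on $\Omega\setminus\{\Phi'=0\}$; in particular $(f^n)'\neq0$ locally on this set for all large $n$. -/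

import Mathlib

open Filter Topology Asymptotics

/-- A meromorphic function on `ℂ` is represented by a function `f : ℂ → ℂ` in normal form
(`MeromorphicNFOn f Set.univ`): it is holomorphic off its poles, and the value at a pole is
irrelevant below.  `prePoles f` is the set `⋃_{n ≥ 1} f⁻ⁿ(∞)` of the points of `ℂ` whose orbit
reaches a pole.  (For the least such `k`, the points `z, f z, …, f^[k] z` are honest iterates, so
the value of `f` at a pole does not matter.) -/
def prePoles (f : ℂ → ℂ) : Set ℂ :=
  {z | ∃ k : ℕ, meromorphicOrderAt f (f^[k] z) < 0}

/-- Normality of a sequence of holomorphic functions on a (connected) domain `U`: every subsequence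
has a further subsequence that, locally uniformly on `U`, converges to a finite function or
diverges to `∞`. -/
def IsNormalOn (F : ℕ → ℂ → ℂ) (U : Set ℂ) : Prop :=
  ∀ φ : ℕ → ℕ, StrictMono φ → ∃ ψ : ℕ → ℕ, StrictMono ψ ∧
    ((∃ g : ℂ → ℂ, TendstoLocallyUniformlyOn (fun n => F (φ (ψ n))) g atTop U) ∨
      (∀ K : Set ℂ, K ⊆ U → IsCompact K → ∀ R : ℝ,
        ∀ᶠ n in atTop, ∀ z ∈ K, R ≤ ‖F (φ (ψ n)) z‖))

/-- The Fatou set of a meromorphic function on `ℂ`: the region of normality of the iterates of `f`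
restricted to the complement of the closure of `⋃_{n ≥ 1} f⁻ⁿ(∞)`. -/
def fatouSet (f : ℂ → ℂ) : Set ℂ :=
  {z | ∃ r : ℝ, 0 < r ∧ Metric.ball z r ⊆ (closure (prePoles f))ᶜ ∧
    IsNormalOn (fun n => f^[n]) (Metric.ball z r)}

/-- The (attracting or parabolic) basin of `f` associated to the fixed point `a` of `f^p`. -/
def basin (f : ℂ → ℂ) (p : ℕ) (a : ℂ) : Set ℂ :=
  {z | z ∈ fatouSet f ∧ ∃ j : ℕ, Tendsto (fun n : ℕ => f^[p * n + j] z) atTop (𝓝 a)}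

/-- `Φ` is a solution of the Schröder equation `Φ ∘ f = c Φ` on the basin, where `c` is a `p`-th
root of the multiplier `(f^p)'(a)`, with `Φ' ≠ 0` at every point of the cycle. -/
structure IsSchroederSolution (f : ℂ → ℂ) (p : ℕ) (a c : ℂ) (Φ : ℂ → ℂ) : Prop where
  root : c ^ p = deriv (f^[p]) a
  holo : DifferentiableOn ℂ Φ (basin f p a)
  eqn : ∀ z ∈ basin f p a, Φ (f z) = c * Φ z
  deriv_ne : ∀ j < p, deriv Φ (f^[j] a) ≠ 0

/-- The unit vector `u` is an attracting direction of `g` at `ζ`: near `ζ`,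
`g z = z + b (z - ζ)^(k+1) + o((z - ζ)^(k+1))` for some `k ≥ 1` and `b` such that `b u^k` is a
negative real number (so `b ≠ 0`, and `ζ` is a multiple fixed point). -/
def IsAttractingDirection (g : ℂ → ℂ) (ζ u : ℂ) : Prop :=
  ‖u‖ = 1 ∧ ∃ k : ℕ, 1 ≤ k ∧ ∃ b : ℂ,
    (fun z => g z - z - b * (z - ζ) ^ (k + 1)) =o[𝓝 ζ] (fun z => (z - ζ) ^ (k + 1)) ∧
    ∃ s : ℝ, 0 < s ∧ b * u ^ k = -(s : ℂ)

/-- The sequence `x` converges to `ζ` from the direction of the unit vector `u` (in particular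
`x n ≠ ζ` for large `n`). -/
def ConvergesFrom (x : ℕ → ℂ) (ζ u : ℂ) : Prop :=
  Tendsto x atTop (𝓝 ζ) ∧
    Tendsto (fun n => (x n - ζ) / ((‖x n - ζ‖ : ℝ) : ℂ)) atTop (𝓝 u)

/-- `P` is an attracting petal of `f^p` at its fixed point `ζ` for the direction `u`: an open set on
which all iterates of `f` are defined, which `f^p` maps univalently into itself, and such that an
orbit under `f^p` is eventually absorbed by `P` if and only if it converges to `ζ` from the
direction `u`. -/
structure IsAttractingPetal (f : ℂ → ℂ) (p : ℕ) (ζ u : ℂ) (P : Set ℂ) : Prop where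
  isOpen : IsOpen P
  defined : P ⊆ (prePoles f)ᶜ
  mapsTo : Set.MapsTo (f^[p]) P P
  injOn : Set.InjOn (f^[p]) P
  absorbs : ∀ z, z ∉ prePoles f →
    ((∀ᶠ n : ℕ in atTop, f^[p * n] z ∈ P) ↔ ConvergesFrom (fun n => f^[p * n] z) ζ u)

/-- `Φ` is a solution of the Abel equation `Φ ∘ f = Φ + 1/p` on the basin, injective on every
attracting petal of `f^p` at every point `f^j(a)` of the cycle. -/
structure IsAbelSolution (f : ℂ → ℂ) (p : ℕ) (a : ℂ) (Φ : ℂ → ℂ) : Prop where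
  holo : DifferentiableOn ℂ Φ (basin f p a)
  eqn : ∀ z ∈ basin f p a, Φ (f z) = Φ z + 1 / (p : ℂ)
  injOn : ∀ j < p, ∀ u : ℂ, IsAttractingDirection (f^[p]) (f^[j] a) u →
    ∀ P : Set ℂ, IsAttractingPetal f p (f^[j] a) u P → Set.InjOn Φ P

/-- `(f^n)^{(t)} / (f^n)' = Φ^{(t)} / Φ' + O(r n)` as `n → ∞`, locally uniformly on `S`; the
denominators `(f^n)'` are nonzero, so that the quotients make sense. -/
def DerivQuotientApprox (f Φ : ℂ → ℂ) (t : ℕ) (r : ℕ → ℝ) (S : Set ℂ) : Prop :=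
  ∀ z ∈ S, ∃ U ∈ 𝓝[S] z, ∃ C : ℝ, ∀ᶠ n : ℕ in atTop, ∀ w ∈ U,
    deriv (f^[n]) w ≠ 0 ∧
    ‖iteratedDeriv t (f^[n]) w / deriv (f^[n]) w - iteratedDeriv t Φ w / deriv Φ w‖ ≤ C * r n

/-!
Write `q = Φ'' / Φ' ^ 2`. On the basin the functional equation iterates to `Φ ∘ f^[n] = cⁿ Φ + const`,
with `c = 1` in the parabolic case. Differentiating it twice gives `(f^[n])' ≠ 0` wherever
`Φ' ≠ 0`, together with the exact identity
`(f^[n])'' / (f^[n])' - Φ'' / Φ' = -q (f^[n] z) cⁿ Φ' z` (`quotient_sub_quotient_eq`). So for `t = 2`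
the error is governed by the size of `q` along orbits. The quotients with larger `t` follow from
`X_{t+1} = X_t' + X_t X_2`, where `X_t = F⁽ᵗ⁾ / F'`, and Cauchy's estimate
(`iteratedDeriv_div_deriv_approx`).

In the attracting case `q` is bounded near the cycle because `Φ'` does not vanish there, and the
error is `O(|c|ⁿ)`.

In the parabolic case `q (f^[n] z) = O(1 / n)` is a consequence of the univalence of `Φ` on petals.
Near a point `ζ` of the cycle, `g = f^[p]` has the form `z + b (z - ζ) ^ (k + 1) + ⋯`, and in the
coordinate `-1 / (k b (z - ζ) ^ k)` it is close to the translation by `1`. Preimages of half-planes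
in this coordinate are attracting petals (`isAttractingPetal_petal`), every orbit converging to `ζ`
without reaching it enters one (`IsParabolicOn.exists_mem_petal`), and `‖z - ζ‖ ^ k` has size `1 / n`
at its `n`-th point. Koebe distortion (`norm_deriv_deriv_mul_le_of_injOn`) on a disc of radius
comparable to `‖z - ζ‖`, combined with `Φ (g z) - Φ z = 1` and `g z - z = O(‖z - ζ‖ ^ (k + 1))`, gives
`q z = O(‖z - ζ‖ ^ k)` (`IsParabolicOn.exists_bound`). The distortion bound is proved with the
square root of `1 - (h - h c) / α`, where `h c + α` is an omitted value of the univalent function `h`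
nearest to `h c`, and the Schwarz lemma for the inverse of `h`.

Two facts about the basin are needed throughout. It is forward invariant, since `f` is an open map
and hence preserves the Fatou set. It is open, since its orbits enter uniformly absorbed open sets;
in the parabolic case this uses that no orbit in the basin reaches the cycle, for a cycle in the
basin would contradict the Abel equation.
-/

/-! ### Univalent functions -/

/-- A holomorphic function that is injective on an open set maps it onto an open set, and its
inverse is holomorphic. -/
theorem exists_holomorphic_inverse {h : ℂ → ℂ} {D : Set ℂ} (hD : IsOpen D)
    (hd : DifferentiableOn ℂ h D) (hi : Set.InjOn h D) :
    IsOpen (h '' D) ∧ ∃ k : ℂ → ℂ, DifferentiableOn ℂ k (h '' D) ∧ ∀ x ∈ D, k (h x) = x := by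
  have han : AnalyticOnNhd ℂ h D := hd.analyticOnNhd hD
  have hnc : ∀ x ∈ D, ¬ ∀ᶠ z in 𝓝 x, h z = h x := by
    intro x hx hc
    have h1 : ∀ᶠ z in 𝓝[≠] x, False := by
      filter_upwards [nhdsWithin_le_nhds hc, nhdsWithin_le_nhds (hD.mem_nhds hx),
        self_mem_nhdsWithin] with z hz hzD hzx
      exact hzx (hi hzD hx hz)
    exact (NormedField.nhdsNE_neBot x).ne (by simpa using h1)
  have hmap : ∀ x ∈ D, 𝓝 (h x) ≤ map h (𝓝 x) := fun x hx =>
    ((han x hx).eventually_constant_or_nhds_le_map_nhds).resolve_left (hnc x hx)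
  have hopen : IsOpen (h '' D) := by
    rw [isOpen_iff_mem_nhds]
    rintro _ ⟨x, hx, rfl⟩
    exact hmap x hx (image_mem_map (hD.mem_nhds hx))
  set k := Function.invFunOn h D with hk
  have hkh : ∀ x ∈ D, k (h x) = x := fun x hx => hi.leftInvOn_invFunOn hx
  have hcont : ∀ x ∈ D, ContinuousAt k (h x) := by
    intro x hx V hV
    rw [hkh x hx] at hV
    have := hmap x hx (image_mem_map (inter_mem hV (hD.mem_nhds hx)))
    refine mem_map.2 (mem_of_superset this ?_)
    rintro _ ⟨y, ⟨hyV, hyD⟩, rfl⟩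
    simpa [hkh y hyD] using hyV
  have hinv : ∀ x ∈ D, ∀ᶠ y in 𝓝 (h x), h (k y) = y := by
    intro x hx
    filter_upwards [hopen.mem_nhds ⟨x, hx, rfl⟩]
    rintro _ ⟨y, hy, rfl⟩
    rw [hkh y hy]
  have hdiff : ∀ x ∈ D, deriv h x ≠ 0 → DifferentiableAt ℂ k (h x) := by
    intro x hx hne
    have h1 : HasDerivAt h (deriv h x) (k (h x)) := by
      rw [hkh x hx]; exact (han x hx).differentiableAt.hasDerivAt
    exact (HasDerivAt.of_local_left_inverse (hcont x hx) h1 hne (hinv x hx)).differentiableAt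
  refine ⟨hopen, k, ?_, hkh⟩
  rintro _ ⟨x, hx, rfl⟩
  refine DifferentiableAt.differentiableWithinAt ?_
  -- the critical points of `h` are isolated, so their images are removable for the inverse
  have hiso : ∀ᶠ z in 𝓝[≠] x, deriv h z ≠ 0 := by
    refine ((han x hx).deriv.eventually_eq_zero_or_eventually_ne_zero).resolve_left ?_
    intro h0
    apply hnc x hx
    obtain ⟨r, hr, hball⟩ := Metric.mem_nhds_iff.1 (inter_mem h0 (hD.mem_nhds hx))
    filter_upwards [Metric.ball_mem_nhds x hr] with z hz
    exact (convex_ball x r).is_const_of_fderivWithin_eq_zero (𝕜 := ℂ)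
      (hd.mono fun y hy => (hball hy).2) (fun y hy => by
        rw [fderivWithin_of_isOpen Metric.isOpen_ball hy]
        ext; simpa using (hball hy).1) hz (Metric.mem_ball_self hr)
  have hpunct : ∀ᶠ y in 𝓝[≠] (h x), DifferentiableAt ℂ k y := by
    rw [eventually_nhdsWithin_iff] at hiso ⊢
    filter_upwards [hmap x hx (image_mem_map (inter_mem hiso (hD.mem_nhds hx)))]
    rintro _ ⟨y, ⟨hy, hyD⟩, rfl⟩ hne
    exact hdiff y hyD (hy fun e => hne (by rw [e]; rfl))
  exact (Complex.analyticAt_of_differentiable_on_punctured_nhds_of_continuousAt hpunct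
    (hcont x hx)).differentiableAt

/-- If the image of a disc of radius `d` under a univalent function contains a disc of radius `ρ`
about the image of the centre, then `ρ ≤ d |h'|`: this is the Schwarz lemma for the inverse. -/
theorem radius_le_of_ball_subset_image {h : ℂ → ℂ} {c : ℂ} {d ρ : ℝ} (hd0 : 0 < d) (hρ : 0 < ρ)
    (hd : DifferentiableOn ℂ h (Metric.ball c d)) (hi : Set.InjOn h (Metric.ball c d))
    (hsub : Metric.ball (h c) ρ ⊆ h '' Metric.ball c d) : ρ ≤ d * ‖deriv h c‖ := by
  obtain ⟨ho, k, hk, hkh⟩ := exists_holomorphic_inverse Metric.isOpen_ball hd hi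
  have hc : c ∈ Metric.ball c d := Metric.mem_ball_self hd0
  have h1 := (hk.differentiableAt (ho.mem_nhds ⟨c, hc, rfl⟩)).hasDerivAt
  have h2 := (hd.differentiableAt (Metric.isOpen_ball.mem_nhds hc)).hasDerivAt
  have h3 := h1.comp c h2
  have h4 : HasDerivAt (k ∘ h) 1 c := (hasDerivAt_id c).congr_of_eventuallyEq (by
    filter_upwards [Metric.isOpen_ball.mem_nhds hc] with y hy using hkh y hy)
  have h5 := h3.unique h4
  have h6 : ‖deriv k (h c)‖ ≤ d / ρ := by
    refine Complex.norm_deriv_le_div_of_mapsTo_ball (hk.mono hsub) ?_ hρ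
    intro y hy
    obtain ⟨x, hx, rfl⟩ := hsub hy
    rw [hkh x hx, hkh c hc]
    exact Metric.ball_subset_closedBall hx
  have h7 : 1 = ‖deriv k (h c)‖ * ‖deriv h c‖ := by rw [← norm_mul, h5, norm_one]
  have h8 : 1 ≤ d / ρ * ‖deriv h c‖ := by
    rw [h7]; gcongr
  rw [div_mul_eq_mul_div, le_div_iff₀ hρ] at h8
  linarith

/-- A zero-free holomorphic function on a disc, equal to `1` at the centre, has a holomorphic
square root. -/
theorem exists_sqrt_on_ball {v : ℂ → ℂ} {c : ℂ} {d : ℝ} (hd0 : 0 < d)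
    (hv : DifferentiableOn ℂ v (Metric.ball c d)) (hne : ∀ z ∈ Metric.ball c d, v z ≠ 0)
    (hvc : v c = 1) : ∃ q : ℂ → ℂ, DifferentiableOn ℂ q (Metric.ball c d) ∧ q c = 1 ∧
      ∀ z ∈ Metric.ball c d, q z ^ 2 = v z := by
  have hdv : DifferentiableOn ℂ (fun z => deriv v z / v z) (Metric.ball c d) :=
    (hv.deriv Metric.isOpen_ball).div hv hne
  obtain ⟨L, hLc, hL⟩ := hdv.isExactOn_ball.with_val_at c 0
  have hLd : DifferentiableOn ℂ L (Metric.ball c d) := fun z hz =>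
    (hL z hz).differentiableAt.differentiableWithinAt
  have hconst : ∀ z ∈ Metric.ball c d, v z * Complex.exp (-L z) = v c * Complex.exp (-L c) := by
    intro z hz
    refine (convex_ball c d).is_const_of_fderivWithin_eq_zero (𝕜 := ℂ)
      (f := fun z => v z * Complex.exp (-L z))
      (hv.mul hLd.neg.cexp) (fun y hy => ?_) hz (Metric.mem_ball_self hd0)
    rw [fderivWithin_of_isOpen Metric.isOpen_ball hy]
    have h1 := (hv.differentiableAt (Metric.isOpen_ball.mem_nhds hy)).hasDerivAt
    have h2 := h1.mul ((hL y hy).neg.cexp)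
    have h3 := hne y hy
    have h4 : HasDerivAt (fun z => v z * Complex.exp (-L z)) 0 y := by
      refine h2.congr_deriv ?_
      field_simp
      ring
    have h5 := h4.hasFDerivAt.fderiv
    rw [h5]; ext; simp
  refine ⟨fun z => Complex.exp (L z / 2), (hLd.div_const 2).cexp, by simp [hLc], fun z hz => ?_⟩
  have h1 := hconst z hz
  rw [hvc, hLc] at h1
  simp only [← Complex.exp_nat_mul]
  rw [Complex.exp_neg, ← div_eq_mul_inv, div_eq_iff (Complex.exp_ne_zero _)] at h1
  rw [h1]
  simp only [neg_zero, Complex.exp_zero, mul_one, one_mul]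
  congr 1
  push_cast; ring

/-- Let `h` be univalent with an image containing the disc of radius `‖α‖` about `h c`. A zero-free
square root `q` of `1 - (h - h c) / α` with `q c = 1` stays away from `-1`, because its image
contains the disc of radius `2 / 5` about `1` and is disjoint from its own negative. -/
theorem two_fifths_le_norm_sqrt_add_one {h q : ℂ → ℂ} {c α : ℂ} {d : ℝ} (hd0 : 0 < d)
    (hα : α ≠ 0) (hi : Set.InjOn h (Metric.ball c d))
    (hsub : Metric.ball (h c) ‖α‖ ⊆ h '' Metric.ball c d)
    (hq : DifferentiableOn ℂ q (Metric.ball c d)) (hqc : q c = 1)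
    (hq2 : ∀ z ∈ Metric.ball c d, q z ^ 2 = 1 - (h z - h c) / α)
    (hq0 : ∀ z ∈ Metric.ball c d, q z ≠ 0) {z : ℂ} (hz : z ∈ Metric.ball c d) :
    2 / 5 ≤ ‖q z + 1‖ := by
  have hsq : ∀ z ∈ Metric.ball c d, ∀ w ∈ Metric.ball c d, q z ^ 2 = q w ^ 2 → z = w := by
    intro z hz w hw e
    rw [hq2 z hz, hq2 w hw, sub_right_inj, div_left_inj' hα, sub_left_inj] at e
    exact hi hz hw e
  have hqi : Set.InjOn q (Metric.ball c d) := fun z hz w hw e => hsq z hz w hw (by rw [e])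
  obtain ⟨hA, -⟩ := exists_holomorphic_inverse Metric.isOpen_ball hq hqi
  have hdisj : Disjoint (q '' Metric.ball c d) (-(q '' Metric.ball c d)) := by
    rw [Set.disjoint_left]
    rintro _ ⟨z, hz, rfl⟩ hn
    obtain ⟨w, hw, e⟩ := hn
    have := hsq w hw z hz (by rw [e, neg_sq])
    subst this
    exact hq0 w hw (self_eq_neg.1 e)
  have hcover : Metric.ball (1 : ℂ) (2 / 5) ⊆ q '' Metric.ball c d ∪ -(q '' Metric.ball c d) := by
    intro v hv
    rw [mem_ball_iff_norm] at hv
    have h1 : ‖1 - v ^ 2‖ < 1 := by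
      have e : 1 - v ^ 2 = -((v - 1) * ((v - 1) + 2)) := by ring
      rw [e, norm_neg, norm_mul]
      have : ‖v - 1 + 2‖ ≤ ‖v - 1‖ + 2 := (norm_add_le _ _).trans (by simp)
      nlinarith [norm_nonneg (v - 1)]
    have h2 : h c + α * (1 - v ^ 2) ∈ Metric.ball (h c) ‖α‖ := by
      rw [mem_ball_iff_norm, add_sub_cancel_left, norm_mul]
      exact mul_lt_of_lt_one_right (norm_pos_iff.2 hα) h1
    obtain ⟨z, hz, e⟩ := hsub h2
    have h3 : q z ^ 2 = v ^ 2 := by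
      rw [hq2 z hz, e]; field_simp; ring
    rcases sq_eq_sq_iff_eq_or_eq_neg.1 h3 with h | h
    · exact Or.inl ⟨z, hz, h⟩
    · exact Or.inr ⟨z, hz, h⟩
  have hT : Metric.ball (1 : ℂ) (2 / 5) ⊆ q '' Metric.ball c d :=
    IsPreconnected.subset_left_of_subset_union hA hA.neg hdisj hcover
      ⟨1, Metric.mem_ball_self (by norm_num), c, Metric.mem_ball_self hd0, hqc⟩
      (convex_ball _ _).isPreconnected
  by_contra hlt
  push Not at hlt
  have h1 : -q z ∈ q '' Metric.ball c d := hT (by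
    rw [mem_ball_iff_norm, ← norm_neg, show -(-q z - 1) = q z + 1 by ring]; exact hlt)
  exact Set.disjoint_left.1 hdisj ⟨z, hz, rfl⟩ h1

/-- Koebe's distortion theorem in its infinitesimal form, with a non-sharp constant: the second
derivative of a univalent function at the centre of a disc is controlled by the first. -/
theorem norm_deriv_deriv_mul_le_of_injOn {h : ℂ → ℂ} {c : ℂ} {d : ℝ} (hd0 : 0 < d)
    (hd : DifferentiableOn ℂ h (Metric.ball c d)) (hi : Set.InjOn h (Metric.ball c d)) :
    ‖deriv (deriv h) c‖ * d ≤ 1760 * ‖deriv h c‖ := by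
  obtain ⟨ho, -⟩ := exists_holomorphic_inverse Metric.isOpen_ball hd hi
  have hcD : c ∈ Metric.ball c d := Metric.mem_ball_self hd0
  -- by the Schwarz lemma the image is not the whole plane
  have hne : (h '' Metric.ball c d)ᶜ.Nonempty := by
    rw [Set.nonempty_compl]
    intro hu
    have := radius_le_of_ball_subset_image hd0 (ρ := d * ‖deriv h c‖ + 1) (by positivity) hd hi
      (by rw [hu]; exact Set.subset_univ _)
    linarith
  -- an omitted value nearest to `h c`
  obtain ⟨α₀, hα₀, hdist⟩ := ho.isClosed_compl.exists_infDist_eq_dist hne (h c)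
  set α := α₀ - h c with hαdef
  have hα : α ≠ 0 := by
    intro h0
    exact hα₀ ⟨c, hcD, (sub_eq_zero.1 h0).symm⟩
  have hsub : Metric.ball (h c) ‖α‖ ⊆ h '' Metric.ball c d := by
    intro y hy
    by_contra hny
    have h1 := Metric.infDist_le_dist_of_mem (x := h c) (Set.mem_compl hny)
    rw [hdist, dist_comm (h c) α₀, dist_comm (h c) y, dist_eq_norm α₀] at h1
    exact absurd hy (by simpa using h1)
  have hαle : ‖α‖ ≤ d * ‖deriv h c‖ :=
    radius_le_of_ball_subset_image hd0 (norm_pos_iff.2 hα) hd hi hsub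
  have hvne : ∀ z ∈ Metric.ball c d, 1 - (h z - h c) / α ≠ 0 := by
    intro z hz h0
    refine hα₀ ⟨z, hz, ?_⟩
    rw [sub_eq_zero, eq_div_iff hα, one_mul] at h0
    linear_combination -h0
  obtain ⟨q, hq, hqc, hq2⟩ := exists_sqrt_on_ball (v := fun z => 1 - (h z - h c) / α) hd0
    (((hd.sub_const _).div_const _).const_sub _) hvne (by simp)
  have hq0 : ∀ z ∈ Metric.ball c d, q z ≠ 0 := by
    intro z hz h0
    apply hvne z hz
    rw [← hq2 z hz, h0]; simp
  have hlow : ∀ z ∈ Metric.ball c d, 2 / 5 ≤ ‖q z + 1‖ := fun z hz =>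
    two_fifths_le_norm_sqrt_add_one hd0 hα hi hsub hq hqc hq2 hq0 hz
  have hq1 : ∀ z ∈ Metric.ball c d, q z + 1 ≠ 0 := fun z hz h0 => by
    have := hlow z hz
    rw [h0, norm_zero] at this
    linarith
  -- `h` is an explicit function of the bounded function `B = 1 / (q + 1)`
  set B : ℂ → ℂ := fun z => (q z + 1)⁻¹ with hB
  have hBd : DifferentiableOn ℂ B (Metric.ball c d) := (hq.add_const 1).inv hq1
  have hB0 : ∀ z ∈ Metric.ball c d, B z ≠ 0 := fun z hz => inv_ne_zero (hq1 z hz)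
  have hBc : B c = 1 / 2 := by simp only [hB, hqc]; norm_num
  have hBle : ∀ z ∈ Metric.ball c d, ‖B z‖ ≤ 5 / 2 := by
    intro z hz
    rw [hB, norm_inv]
    exact (inv_anti₀ (by norm_num) (hlow z hz)).trans_eq (by norm_num)
  have hhB : ∀ z ∈ Metric.ball c d, h z = h c + α * (2 / B z - 1 / B z ^ 2) := by
    intro z hz
    have h1 := hq2 z hz
    have h2 := hq1 z hz
    have h3 : h z - h c = α * (1 - q z ^ 2) := by rw [h1]; field_simp; ring
    simp only [hB]
    field_simp
    linear_combination h3
  have hcb : Metric.closedBall c (d / 2) ⊆ Metric.ball c d :=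
    Metric.closedBall_subset_ball (by linarith)
  have hcl : DiffContOnCl ℂ B (Metric.ball c (d / 2)) :=
    (hBd.mono (by rw [closure_ball c (by positivity : d / 2 ≠ 0)]; exact hcb)).diffContOnCl
  have hcauchy := fun n => Complex.norm_iteratedDeriv_le_of_forall_mem_sphere_norm_le n
    (half_pos hd0) hcl (fun z hz => hBle z (hcb (Metric.sphere_subset_closedBall hz)))
  have hB1 : ‖deriv B c‖ ≤ 5 / d := by
    have := hcauchy 1
    rw [iteratedDeriv_one] at this
    refine this.trans_eq ?_
    field_simp; norm_num
  have hB2 : ‖deriv (deriv B) c‖ ≤ 20 / d ^ 2 := by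
    have := hcauchy 2
    rw [iteratedDeriv_succ, iteratedDeriv_one] at this
    refine this.trans_eq ?_
    rw [Nat.factorial_two]; field_simp; norm_num
  have hBder : ∀ z ∈ Metric.ball c d, HasDerivAt B (deriv B z) z := fun z hz =>
    (hBd.differentiableAt (Metric.isOpen_ball.mem_nhds hz)).hasDerivAt
  have hBder2 : HasDerivAt (deriv B) (deriv (deriv B) c) c :=
    ((hBd.deriv Metric.isOpen_ball).differentiableAt (Metric.isOpen_ball.mem_nhds hcD)).hasDerivAt
  have hh1 : ∀ z ∈ Metric.ball c d,
      deriv h z = α * (-2 * deriv B z / B z ^ 2 + 2 * deriv B z / B z ^ 3) := by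
    intro z hz
    have hb := hB0 z hz
    have h1 : HasDerivAt (fun z => h c + α * (2 / B z - 1 / B z ^ 2))
        (α * (-2 * deriv B z / B z ^ 2 + 2 * deriv B z / B z ^ 3)) z := by
      have h2 := (hasDerivAt_const z (2 : ℂ)).div (hBder z hz) hb
      have h3 := (hasDerivAt_const z (1 : ℂ)).div ((hBder z hz).pow 2) (pow_ne_zero 2 hb)
      refine (((h2.sub h3).const_mul α).const_add (h c)).congr_deriv ?_
      simp only [Pi.pow_apply]
      field_simp
      ring
    refine (h1.congr_of_eventuallyEq ?_).deriv
    filter_upwards [Metric.isOpen_ball.mem_nhds hz] with y hy using hhB y hy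
  have hh2 : deriv (deriv h) c = α * (8 * deriv (deriv B) c - 64 * deriv B c ^ 2) := by
    have h1 : HasDerivAt (fun z => α * (-2 * deriv B z / B z ^ 2 + 2 * deriv B z / B z ^ 3))
        (α * (8 * deriv (deriv B) c - 64 * deriv B c ^ 2)) c := by
      have hb := hB0 c hcD
      have h2 := (hBder2.const_mul (-2)).div ((hBder c hcD).pow 2) (pow_ne_zero 2 hb)
      have h3 := (hBder2.const_mul 2).div ((hBder c hcD).pow 3) (pow_ne_zero 3 hb)
      refine ((h2.add h3).const_mul α).congr_deriv ?_
      refine congrArg (α * ·) ?_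
      simp only [Pi.pow_apply, hBc]
      norm_num
      ring
    refine (h1.congr_of_eventuallyEq ?_).deriv
    filter_upwards [Metric.isOpen_ball.mem_nhds hcD] with y hy using hh1 y hy
  have h3 : ‖8 * deriv (deriv B) c - 64 * deriv B c ^ 2‖ ≤ 1760 / d ^ 2 := by
    calc ‖8 * deriv (deriv B) c - 64 * deriv B c ^ 2‖
        ≤ ‖8 * deriv (deriv B) c‖ + ‖64 * deriv B c ^ 2‖ := norm_sub_le _ _
      _ = 8 * ‖deriv (deriv B) c‖ + 64 * ‖deriv B c‖ ^ 2 := by simp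
      _ ≤ 8 * (20 / d ^ 2) + 64 * (5 / d) ^ 2 := by gcongr
      _ = 1760 / d ^ 2 := by field_simp; norm_num
  calc ‖deriv (deriv h) c‖ * d
      = ‖α‖ * ‖8 * deriv (deriv B) c - 64 * deriv B c ^ 2‖ * d := by rw [hh2, norm_mul]
    _ ≤ (d * ‖deriv h c‖) * (1760 / d ^ 2) * d := by gcongr
    _ = 1760 * ‖deriv h c‖ := by field_simp

/-- If a univalent function on a disc of radius `d` moves apart by `1` two points at distance at most
`ρ ≪ d`, then its derivative is at least of order `1 / ρ` nearby, and the quotient `h'' / h' ^ 2` is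
`O(ρ / d)` at the centre. The constant `8000` is a convenient number above `4 * 1760`. -/
theorem norm_deriv_deriv_div_sq_le {h : ℂ → ℂ} {x y : ℂ} {d ρ : ℝ} (hρ : 0 < ρ)
    (hρd : 8000 * ρ ≤ d) (hd : DifferentiableOn ℂ h (Metric.ball x d))
    (hi : Set.InjOn h (Metric.ball x d)) (hy : ‖y - x‖ ≤ ρ) (hxy : ‖h y - h x‖ = 1) :
    ‖deriv (deriv h) x / deriv h x ^ 2‖ ≤ 8000 * ρ / d := by
  have hd0 : 0 < d := by linarith
  have hsub : ∀ y ∈ Metric.closedBall x ρ, Metric.ball y (d / 2) ⊆ Metric.ball x d := by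
    intro y hy
    refine Metric.ball_subset_ball' ?_
    have := Metric.mem_closedBall.1 hy
    linarith
  have hmem : ∀ y ∈ Metric.closedBall x ρ, y ∈ Metric.ball x d := fun y hy =>
    hsub y hy (Metric.mem_ball_self (by positivity))
  have hder := hd.deriv Metric.isOpen_ball
  have hxm : x ∈ Metric.closedBall x ρ := Metric.mem_closedBall_self hρ.le
  obtain ⟨m, hm, hmax⟩ := (isCompact_closedBall x ρ).exists_isMaxOn ⟨x, hxm⟩
    ((hder.continuousOn.mono fun y hy => hmem y hy).norm)
  set M := ‖deriv h m‖ with hM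
  have hle : ∀ y ∈ Metric.closedBall x ρ, ‖deriv h y‖ ≤ M := fun y hy => hmax hy
  have hK : ∀ y ∈ Metric.closedBall x ρ, ‖deriv (deriv h) y‖ ≤ 3520 * M / d := by
    intro y hy
    have h1 := norm_deriv_deriv_mul_le_of_injOn (half_pos hd0) (hd.mono (hsub y hy))
      (hi.mono (hsub y hy))
    rw [le_div_iff₀ hd0]
    nlinarith [hle y hy]
  have h1 : 1 ≤ M * ρ := by
    have h2 := (convex_closedBall x ρ).norm_image_sub_le_of_norm_deriv_le (𝕜 := ℂ) (f := h)
      (fun z hz => hd.differentiableAt (Metric.isOpen_ball.mem_nhds (hmem z hz))) hle hxm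
      (y := y) (mem_closedBall_iff_norm.2 hy)
    rw [hxy] at h2
    exact h2.trans (by gcongr)
  have hM0 : 0 < M := by
    by_contra h0
    push Not at h0
    nlinarith
  have h2 : ‖deriv h x - deriv h m‖ ≤ M / 2 := by
    have h3 := (convex_closedBall x ρ).norm_image_sub_le_of_norm_deriv_le (𝕜 := ℂ) (f := deriv h)
      (fun z hz => hder.differentiableAt (Metric.isOpen_ball.mem_nhds (hmem z hz))) hK hm hxm
    refine h3.trans ?_
    have h4 : ‖x - m‖ ≤ ρ := by rw [norm_sub_rev]; exact mem_closedBall_iff_norm.1 hm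
    calc 3520 * M / d * ‖x - m‖ ≤ 3520 * M / d * ρ := by gcongr
      _ ≤ M / 2 := by
        rw [div_mul_eq_mul_div, div_le_iff₀ hd0]
        nlinarith
  have h3 : M / 2 ≤ ‖deriv h x‖ := by
    have := norm_sub_norm_le (deriv h m) (deriv h x)
    rw [norm_sub_rev] at this
    linarith
  have hx0 : 0 < ‖deriv h x‖ := by linarith
  have h4 := norm_deriv_deriv_mul_le_of_injOn hd0 hd hi
  rw [norm_div, norm_pow, div_le_div_iff₀ (by positivity) hd0]
  have h5 : 1 ≤ 2 * ‖deriv h x‖ * ρ := h1.trans (by gcongr; linarith)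
  calc ‖deriv (deriv h) x‖ * d ≤ 1760 * ‖deriv h x‖ * 1 := by linarith
    _ ≤ 1760 * ‖deriv h x‖ * (2 * ‖deriv h x‖ * ρ) := by gcongr
    _ ≤ 8000 * ρ * ‖deriv h x‖ ^ 2 := by nlinarith [sq_nonneg ‖deriv h x‖, mul_nonneg hρ.le (sq_nonneg ‖deriv h x‖)]

/-! ### Quotients of higher derivatives -/

/-- Differentiating `F⁽ᵗ⁾ / F'` yields `F⁽ᵗ⁺¹⁾ / F'` up to products of lower quotients. -/
theorem hasDerivAt_iteratedDeriv_div_deriv {F : ℂ → ℂ} {w : ℂ} (hF : AnalyticAt ℂ F w)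
    (h0 : deriv F w ≠ 0) (t : ℕ) :
    HasDerivAt (fun w => iteratedDeriv t F w / deriv F w)
      (iteratedDeriv (t + 1) F w / deriv F w -
        iteratedDeriv t F w / deriv F w * (iteratedDeriv 2 F w / deriv F w)) w := by
  have h1 : HasDerivAt (iteratedDeriv t F) (iteratedDeriv (t + 1) F w) w := by
    rw [iteratedDeriv_succ]
    have := hF.iterated_deriv t
    rw [← iteratedDeriv_eq_iterate] at this
    exact this.differentiableAt.hasDerivAt
  have h2 : HasDerivAt (deriv F) (iteratedDeriv 2 F w) w := by
    rw [iteratedDeriv_succ, iteratedDeriv_one]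
    exact hF.deriv.differentiableAt.hasDerivAt
  refine (h1.div h2 h0).congr_deriv ?_
  field_simp

/-- If the quotients `Fₙ'' / Fₙ'` approximate `Φ'' / Φ'` uniformly near a point, then all quotients
`Fₙ⁽ᵗ⁾ / Fₙ'` approximate `Φ⁽ᵗ⁾ / Φ'` with the same rate, on smaller discs: the quotient with
index `t + 1` is obtained from that with index `t` by one differentiation and one multiplication,
and Cauchy's estimate controls the derivative. -/
theorem iteratedDeriv_div_deriv_approx {F : ℕ → ℂ → ℂ} {Φ : ℂ → ℂ} {z₀ : ℂ} {R C : ℝ} {r : ℕ → ℝ}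
    (hR : 0 < R) (hr0 : ∀ n, 0 ≤ r n) (hr1 : ∀ n, r n ≤ 1)
    (hΦ : AnalyticOnNhd ℂ Φ (Metric.ball z₀ R)) (hΦ0 : ∀ w ∈ Metric.ball z₀ R, deriv Φ w ≠ 0)
    (hF : ∀ᶠ n in atTop, AnalyticOnNhd ℂ (F n) (Metric.ball z₀ R) ∧
      (∀ w ∈ Metric.ball z₀ R, deriv (F n) w ≠ 0) ∧ ∀ w ∈ Metric.ball z₀ R,
        ‖iteratedDeriv 2 (F n) w / deriv (F n) w - iteratedDeriv 2 Φ w / deriv Φ w‖ ≤ C * r n)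
    {t : ℕ} (ht : 1 ≤ t) :
    ∃ R' : ℝ, 0 < R' ∧ R' ≤ R ∧ ∃ C' : ℝ, 0 ≤ C' ∧ ∀ᶠ n in atTop, ∀ w ∈ Metric.ball z₀ R',
      ‖iteratedDeriv t (F n) w / deriv (F n) w - iteratedDeriv t Φ w / deriv Φ w‖ ≤ C' * r n := by
  induction t, ht using Nat.le_induction with
  | base =>
    refine ⟨R, hR, le_rfl, 0, le_rfl, ?_⟩
    filter_upwards [hF] with n hn w hw
    rw [iteratedDeriv_one, iteratedDeriv_one, div_self (hn.2.1 w hw), div_self (hΦ0 w hw)]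
    simp
  | succ t ht ih =>
    obtain ⟨R', hR', hR'R, C', hC', h⟩ := ih
    have hsub : Metric.closedBall z₀ (R' / 2) ⊆ Metric.ball z₀ R :=
      (Metric.closedBall_subset_ball (by linarith)).trans (Metric.ball_subset_ball hR'R)
    have hbdd : ∀ s, ∃ A : ℝ, ∀ w ∈ Metric.closedBall z₀ (R' / 2),
        ‖iteratedDeriv s Φ w / deriv Φ w‖ ≤ A := by
      intro s
      refine (isCompact_closedBall z₀ (R' / 2)).exists_bound_of_continuousOn fun w hw => ?_
      exact (hasDerivAt_iteratedDeriv_div_deriv (hΦ w (hsub hw)) (hΦ0 w (hsub hw))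
        s).continuousAt.continuousWithinAt
    obtain ⟨A, hA⟩ := hbdd t
    obtain ⟨A₂, hA₂⟩ := hbdd 2
    have hA0 : 0 ≤ A := (norm_nonneg _).trans (hA z₀ (Metric.mem_closedBall_self (by positivity)))
    have hA₂0 : 0 ≤ A₂ :=
      (norm_nonneg _).trans (hA₂ z₀ (Metric.mem_closedBall_self (by positivity)))
    refine ⟨R' / 2, by positivity, by linarith, C' / (R' / 4) + (A + C') * |C| + A₂ * C',
      by positivity, ?_⟩
    filter_upwards [hF, h] with n hn hnt w hw
    obtain ⟨hFa, hF0, hF2⟩ := hn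
    have hwc : w ∈ Metric.closedBall z₀ (R' / 2) := Metric.ball_subset_closedBall hw
    have hwR := hsub hwc
    have hball : Metric.closedBall w (R' / 4) ⊆ Metric.ball z₀ R' := by
      refine Metric.closedBall_subset_ball' ?_
      have := Metric.mem_ball.1 hw
      linarith
    have hdiff : ∀ y ∈ Metric.ball z₀ R, HasDerivAt
        (fun y => iteratedDeriv t (F n) y / deriv (F n) y - iteratedDeriv t Φ y / deriv Φ y) _ y :=
      fun y hy => (hasDerivAt_iteratedDeriv_div_deriv (hFa y hy) (hF0 y hy) t).sub
        (hasDerivAt_iteratedDeriv_div_deriv (hΦ y hy) (hΦ0 y hy) t)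
    have hcl : DiffContOnCl ℂ
        (fun y => iteratedDeriv t (F n) y / deriv (F n) y - iteratedDeriv t Φ y / deriv Φ y)
        (Metric.ball w (R' / 4)) := by
      refine DifferentiableOn.diffContOnCl fun y hy => ?_
      rw [closure_ball w (by positivity : R' / 4 ≠ 0)] at hy
      exact (hdiff y (Metric.ball_subset_ball hR'R
        (hball hy))).differentiableAt.differentiableWithinAt
    have hcauchy := Complex.norm_deriv_le_of_forall_mem_sphere_norm_le
      (by positivity : 0 < R' / 4) hcl
      (fun z hz => hnt z (hball (Metric.sphere_subset_closedBall hz)))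
    rw [(hdiff w hwR).deriv] at hcauchy
    have h1 := hnt w (Metric.ball_subset_ball (by linarith) hw)
    have h2 := hF2 w hwR
    have h3 := hA w hwc
    have h4 := hA₂ w hwc
    set a := iteratedDeriv t (F n) w / deriv (F n) w
    set b := iteratedDeriv t Φ w / deriv Φ w
    set a₂ := iteratedDeriv 2 (F n) w / deriv (F n) w
    set b₂ := iteratedDeriv 2 Φ w / deriv Φ w
    set a' := iteratedDeriv (t + 1) (F n) w / deriv (F n) w
    set b' := iteratedDeriv (t + 1) Φ w / deriv Φ w
    have hrn := hr0 n
    have h5 : ‖a‖ ≤ A + C' := by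
      have e : a = b + (a - b) := by ring
      rw [e]
      refine (norm_add_le _ _).trans (add_le_add h3 (h1.trans ?_))
      nlinarith [hr1 n]
    have h6 : ‖a₂ - b₂‖ ≤ |C| * r n := h2.trans (by gcongr; exact le_abs_self C)
    have e : a' - b' = ((a' - a * a₂) - (b' - b * b₂)) + a * (a₂ - b₂) + b₂ * (a - b) := by ring
    rw [e]
    calc _ ≤ ‖(a' - a * a₂) - (b' - b * b₂)‖ + ‖a * (a₂ - b₂)‖ + ‖b₂ * (a - b)‖ := norm_add₃_le
      _ ≤ C' * r n / (R' / 4) + (A + C') * (|C| * r n) + A₂ * (C' * r n) := by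
        rw [norm_mul, norm_mul]
        gcongr
      _ = (C' / (R' / 4) + (A + C') * |C| + A₂ * C') * r n := by ring

/-! ### Iterates off the prepoles, the Fatou set and the basin -/

theorem analyticAt_of_notMem_prePoles {f : ℂ → ℂ} (hf : MeromorphicNFOn f Set.univ) {z : ℂ}
    (hz : z ∉ prePoles f) : AnalyticAt ℂ f z :=
  (hf (Set.mem_univ z)).meromorphicOrderAt_nonneg_iff_analyticAt.1
    (not_lt.1 fun h => hz ⟨0, h⟩)

theorem iterate_notMem_prePoles {f : ℂ → ℂ} {z : ℂ} (hz : z ∉ prePoles f) (n : ℕ) :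
    f^[n] z ∉ prePoles f := by
  rintro ⟨k, hk⟩
  exact hz ⟨k + n, by rwa [Function.iterate_add_apply]⟩

theorem analyticAt_iterate {f : ℂ → ℂ} (hf : MeromorphicNFOn f Set.univ) {z : ℂ}
    (hz : z ∉ prePoles f) (n : ℕ) : AnalyticAt ℂ f^[n] z := by
  induction n with
  | zero => exact analyticAt_id
  | succ n ih =>
    rw [Function.iterate_succ']
    exact (analyticAt_of_notMem_prePoles hf (iterate_notMem_prePoles hz n)).comp ih

theorem eventually_analyticAt_orbit {f : ℂ → ℂ} (hf : MeromorphicNFOn f Set.univ) {ζ : ℂ}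
    (hζ : ζ ∉ prePoles f) (p : ℕ) : ∀ᶠ x in 𝓝 ζ, ∀ i < p, AnalyticAt ℂ f (f^[i] x) := by
  have h : ∀ᶠ x in 𝓝 ζ, ∀ i ∈ Finset.range p, AnalyticAt ℂ f (f^[i] x) :=
    (Finset.eventually_all _).2 fun i _ => (analyticAt_iterate hf hζ i).continuousAt.eventually
      (analyticAt_of_notMem_prePoles hf (iterate_notMem_prePoles hζ i)).eventually_analyticAt
  exact h.mono fun x hx i hi => hx i (Finset.mem_range.2 hi)

theorem subset_compl_prePoles_of_mapsTo {f : ℂ → ℂ} {p : ℕ} (hp : 1 ≤ p) {V : Set ℂ}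
    (hV : Set.MapsTo f^[p] V V) (han : ∀ x ∈ V, ∀ i < p, AnalyticAt ℂ f (f^[i] x)) :
    V ⊆ (prePoles f)ᶜ := by
  rintro x hx ⟨k, hk⟩
  have h1 := han _ (hV.iterate (k / p) hx) (k % p) (Nat.mod_lt _ hp)
  rw [← Function.iterate_mul, ← Function.iterate_add_apply, Nat.mod_add_div] at h1
  exact absurd hk (not_lt.2 h1.meromorphicOrderAt_nonneg)

theorem subset_compl_closure_prePoles {f : ℂ → ℂ} {U : Set ℂ} (hU : IsOpen U)
    (h : U ⊆ (prePoles f)ᶜ) : U ⊆ (closure (prePoles f))ᶜ := by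
  rw [← interior_compl]
  exact interior_maximal h hU

theorem IsNormalOn.mono {F : ℕ → ℂ → ℂ} {U V : Set ℂ} (h : IsNormalOn F U) (hVU : V ⊆ U) :
    IsNormalOn F V := by
  intro φ hφ
  obtain ⟨ψ, hψ, h⟩ := h φ hφ
  refine ⟨ψ, hψ, h.imp ?_ ?_⟩
  · rintro ⟨g, hg⟩
    exact ⟨g, hg.mono hVU⟩
  · intro h K hK
    exact h K (hK.trans hVU)

theorem isOpen_fatouSet (f : ℂ → ℂ) : IsOpen (fatouSet f) := by
  rw [Metric.isOpen_iff]
  rintro z ⟨r, hr, hsub, hn⟩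
  refine ⟨r / 2, by positivity, fun w hw => ?_⟩
  have h : Metric.ball w (r / 2) ⊆ Metric.ball z r := by
    refine Metric.ball_subset_ball' ?_
    have := Metric.mem_ball.1 hw
    linarith
  exact ⟨r / 2, by positivity, h.trans hsub, hn.mono h⟩

theorem notMem_prePoles_of_mem_fatouSet {f : ℂ → ℂ} {z : ℂ} (hz : z ∈ fatouSet f) :
    z ∉ prePoles f := by
  obtain ⟨r, hr, hsub, -⟩ := hz
  exact fun h => hsub (Metric.mem_ball_self hr) (subset_closure h)

/-- By the identity theorem, a meromorphic function some iterate of which has a non-zero derivative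
somewhere is nowhere locally constant. -/
theorem not_eventually_const {f : ℂ → ℂ} (hf : MeromorphicNFOn f Set.univ) {p : ℕ} (hp : 1 ≤ p)
    {a : ℂ} (ha : a ∉ prePoles f) (h0 : deriv f^[p] a ≠ 0) (z c : ℂ) :
    ¬ ∀ᶠ w in 𝓝 z, f w = c := by
  intro h
  have hm : MeromorphicOn (fun w => f w - c) Set.univ := fun x hx =>
    (hf hx).meromorphicAt.sub (MeromorphicAt.const c x)
  have h1 : meromorphicOrderAt (fun w => f w - c) a = ⊤ := by
    by_contra hne
    refine hm.meromorphicOrderAt_ne_top_of_isPreconnected isPreconnected_univ (Set.mem_univ a)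
      (Set.mem_univ z) hne ?_
    rw [meromorphicOrderAt_eq_top_iff]
    filter_upwards [nhdsWithin_le_nhds h] with w hw
    rw [hw, sub_self]
  rw [meromorphicOrderAt_eq_top_iff] at h1
  have hfa := analyticAt_of_notMem_prePoles hf ha
  have h2 : ∀ᶠ w in 𝓝 a, f w - c = 0 :=
    ((hfa.sub analyticAt_const).frequently_zero_iff_eventually_zero).1 h1.frequently
  have h3 : deriv f a = 0 := by
    have : f =ᶠ[𝓝 a] fun _ => c := h2.mono fun w hw => sub_eq_zero.1 hw
    rw [this.deriv_eq, deriv_const]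
  obtain ⟨q, rfl⟩ : ∃ q, p = q + 1 := ⟨p - 1, by omega⟩
  apply h0
  rw [Function.iterate_succ, deriv_comp _
    (show DifferentiableAt ℂ f^[q] (f a) from
      (analyticAt_iterate hf (iterate_notMem_prePoles ha 1) q).differentiableAt)
    hfa.differentiableAt, h3, mul_zero]

/-- The Fatou set is forward invariant, since a nowhere locally constant meromorphic function is
open. -/
theorem map_mem_fatouSet {f : ℂ → ℂ} (hf : MeromorphicNFOn f Set.univ)
    (hnc : ∀ z c, ¬ ∀ᶠ w in 𝓝 z, f w = c) {z : ℂ} (hz : z ∈ fatouSet f) : f z ∈ fatouSet f := by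
  obtain ⟨r, hr, hsub, hn⟩ := hz
  have hnp : ∀ w ∈ Metric.ball z r, w ∉ prePoles f := fun w hw h => hsub hw (subset_closure h)
  have hmap := ((analyticAt_of_notMem_prePoles hf
    (hnp z (Metric.mem_ball_self hr))).eventually_constant_or_nhds_le_map_nhds).resolve_left
    (hnc z _)
  obtain ⟨s, hs, himg⟩ := Metric.mem_nhds_iff.1
    (hmap (image_mem_map (Metric.closedBall_mem_nhds z (half_pos hr))))
  have hK : Metric.closedBall z (r / 2) ⊆ Metric.ball z r :=
    Metric.closedBall_subset_ball (by linarith)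
  refine ⟨s, hs, subset_compl_closure_prePoles Metric.isOpen_ball ?_, ?_⟩
  · intro y hy
    obtain ⟨x, hx, rfl⟩ := himg hy
    exact iterate_notMem_prePoles (hnp x (hK hx)) 1
  · intro φ hφ
    obtain ⟨ψ, hψ, h⟩ := hn (fun n => φ n + 1) (fun m n h => Nat.succ_lt_succ (hφ h))
    refine ⟨ψ, hψ, h.imp ?_ ?_⟩
    · rintro ⟨g, hg⟩
      have hu := (tendstoLocallyUniformlyOn_iff_tendstoUniformlyOn_of_compact
        (isCompact_closedBall z (r / 2))).1 (hg.mono hK)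
      have himg' : ∀ y ∈ Metric.ball (f z) s, ∃ x, x ∈ Metric.closedBall z (r / 2) ∧ f x = y :=
        himg
      choose! x hx using himg'
      refine ⟨fun y => g (x y), TendstoUniformlyOn.tendstoLocallyUniformlyOn ?_⟩
      intro V hV
      filter_upwards [hu V hV] with n hn y hy
      have := hn (x y) (hx y hy).1
      rwa [Function.iterate_succ_apply, (hx y hy).2] at this
    · intro h K hKs _ R
      filter_upwards [h _ hK (isCompact_closedBall z (r / 2)) R] with n hn y hy
      obtain ⟨x, hx, rfl⟩ := himg (hKs hy)
      exact hn x hx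

theorem map_mem_basin {f : ℂ → ℂ} (hf : MeromorphicNFOn f Set.univ) {p : ℕ} (hp : 1 ≤ p) {a : ℂ}
    (hnc : ∀ z c, ¬ ∀ᶠ w in 𝓝 z, f w = c) {z : ℂ} (hz : z ∈ basin f p a) :
    f z ∈ basin f p a := by
  obtain ⟨hzF, j, hj⟩ := hz
  refine ⟨map_mem_fatouSet hf hnc hzF, j + (p - 1), ?_⟩
  refine (hj.comp (tendsto_add_atTop_nat 1)).congr fun n => ?_
  rw [Function.comp_apply, ← Function.iterate_succ_apply]
  congr 2
  rw [mul_add]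
  omega

theorem iterate_mem_basin {f : ℂ → ℂ} (hf : MeromorphicNFOn f Set.univ) {p : ℕ} (hp : 1 ≤ p) {a : ℂ}
    (hnc : ∀ z c, ¬ ∀ᶠ w in 𝓝 z, f w = c) {z : ℂ} (hz : z ∈ basin f p a) (n : ℕ) :
    f^[n] z ∈ basin f p a := by
  induction n with
  | zero => exact hz
  | succ n ih =>
    rw [Function.iterate_succ_apply']
    exact map_mem_basin hf hp hnc ih

/-- An open set on which `f^[p * m]` converges uniformly to a point of a cycle lies in the Fatou
set: the iterates with exponents in a fixed residue class mod `p` converge there. -/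
theorem subset_fatouSet_of_absorbed {f : ℂ → ℂ} (hf : MeromorphicNFOn f Set.univ) {p : ℕ}
    (hp : 1 ≤ p) {U : Set ℂ} {ζ : ℂ} (hU : IsOpen U) (hUp : U ⊆ (prePoles f)ᶜ)
    (hζ : ζ ∉ prePoles f)
    (habs : ∀ V ∈ 𝓝 ζ, ∀ᶠ m : ℕ in atTop, ∀ x ∈ U, f^[p * m] x ∈ V) : U ⊆ fatouSet f := by
  intro z hz
  obtain ⟨r, hr, hrU⟩ := Metric.isOpen_iff.1 hU z hz
  refine ⟨r, hr, hrU.trans (subset_compl_closure_prePoles hU hUp), ?_⟩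
  intro φ hφ
  obtain ⟨i, hi⟩ : ∃ i, ∃ᶠ n in atTop, φ n % p = i := by
    by_contra! hcon
    have h1 : ∀ᶠ n in atTop, ∀ i ∈ Finset.range p, ¬ φ n % p = i :=
      (Finset.eventually_all _).2 fun i _ => hcon i
    obtain ⟨n, hn⟩ := h1.exists
    exact hn (φ n % p) (Finset.mem_range.2 (Nat.mod_lt _ hp)) rfl
  obtain ⟨ψ, hψ, hψi⟩ := extraction_of_frequently_atTop hi
  refine ⟨ψ, hψ, Or.inl ⟨fun _ => f^[i] ζ, TendstoUniformlyOn.tendstoLocallyUniformlyOn ?_⟩⟩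
  intro V hV
  have hm : Tendsto (fun n => φ (ψ n) / p) atTop atTop :=
    (Nat.tendsto_div_const_atTop (by omega)).comp (hφ.comp hψ).tendsto_atTop
  have h1 := (analyticAt_iterate hf hζ i).continuousAt (UniformSpace.ball_mem_nhds _ hV)
  filter_upwards [hm.eventually (habs _ h1)] with n hn x hx
  have h2 := hn x (hrU hx)
  rw [Set.mem_preimage, ← Function.iterate_add_apply] at h2
  have h3 : i + p * (φ (ψ n) / p) = φ (ψ n) := by
    rw [← hψi n]; exact Nat.mod_add_div _ _
  rw [h3] at h2
  exact h2

/-- An open set on which `f^[p * m]` converges uniformly to a point of the cycle of `a` lies in the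
basin of `a`. -/
theorem subset_basin_of_absorbed {f : ℂ → ℂ} (hf : MeromorphicNFOn f Set.univ) {p : ℕ}
    (hp : 1 ≤ p) {a : ℂ} (ha : a ∉ prePoles f) (hfix : f^[p] a = a) {i : ℕ} (hi : i ≤ p)
    {U : Set ℂ} (hU : IsOpen U) (hUp : U ⊆ (prePoles f)ᶜ)
    (habs : ∀ V ∈ 𝓝 (f^[i] a), ∀ᶠ m : ℕ in atTop, ∀ x ∈ U, f^[p * m] x ∈ V) :
    U ⊆ basin f p a := by
  intro x hx
  have hζ := iterate_notMem_prePoles ha i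
  refine ⟨subset_fatouSet_of_absorbed hf hp hU hUp hζ habs hx, p - i, ?_⟩
  have h1 : Tendsto (fun m : ℕ => f^[p * m] x) atTop (𝓝 (f^[i] a)) := fun V hV =>
    (habs V hV).mono fun m hm => hm x hx
  have h2 := (analyticAt_iterate hf hζ (p - i)).continuousAt.tendsto.comp h1
  rw [← Function.iterate_add_apply, Nat.sub_add_cancel hi, hfix] at h2
  refine h2.congr fun m => ?_
  rw [Function.comp_apply, ← Function.iterate_add_apply, add_comm]

/-! ### The functional equation and the reduction to second derivatives -/

/-- Differentiating the functional equation `Φ ∘ F = C Φ + e` twice. -/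
theorem quotient_sub_quotient_eq {F Φ : ℂ → ℂ} {z C e : ℂ} (hF : AnalyticAt ℂ F z)
    (hΦ : AnalyticAt ℂ Φ z) (hΦF : AnalyticAt ℂ Φ (F z)) (h : ∀ᶠ w in 𝓝 z, Φ (F w) = C * Φ w + e)
    (hC : C ≠ 0) (h0 : deriv Φ z ≠ 0) :
    deriv F z ≠ 0 ∧ iteratedDeriv 2 F z / deriv F z - iteratedDeriv 2 Φ z / deriv Φ z =
      -(deriv (deriv Φ) (F z) / deriv Φ (F z) ^ 2) * (C * deriv Φ z) := by
  have h1 : ∀ᶠ w in 𝓝 z, deriv Φ (F w) * deriv F w = C * deriv Φ w := by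
    filter_upwards [h.eventually_nhds, hF.eventually_analyticAt, hΦ.eventually_analyticAt,
      hF.continuousAt.eventually hΦF.eventually_analyticAt] with w hw hFw hΦw hΦFw
    have e1 := hΦFw.differentiableAt.hasDerivAt.comp w hFw.differentiableAt.hasDerivAt
    have e2 := (hΦw.differentiableAt.hasDerivAt.const_mul C).add_const e
    exact e1.unique (e2.congr_of_eventuallyEq hw)
  have h2 := h1.self_of_nhds
  have h3 : deriv Φ (F z) * deriv F z ≠ 0 := by rw [h2]; exact mul_ne_zero hC h0
  have e1 := (hΦF.deriv.differentiableAt.hasDerivAt.comp z hF.differentiableAt.hasDerivAt).mul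
    hF.deriv.differentiableAt.hasDerivAt
  have e2 := hΦ.deriv.differentiableAt.hasDerivAt.const_mul C
  have h4 := e1.unique (e2.congr_of_eventuallyEq h1)
  refine ⟨right_ne_zero_of_mul h3, ?_⟩
  have hg := left_ne_zero_of_mul h3
  have hF' := right_ne_zero_of_mul h3
  simp only [iteratedDeriv_succ, iteratedDeriv_zero]
  rw [← h2]
  simp only [Function.comp_apply] at h4
  generalize deriv Φ (F z) = G at *
  generalize deriv F z = F' at *
  generalize deriv Φ z = D at *
  have hD : D = G * F' / C := by field_simp; linear_combination -h2
  rw [hD]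
  field_simp
  linear_combination h4

theorem exists_iterate_eq {f : ℂ → ℂ} {S : Set ℂ} {Φ : ℂ → ℂ} {c e : ℂ} (hS : Set.MapsTo f S S)
    (heq : ∀ z ∈ S, Φ (f z) = c * Φ z + e) (n : ℕ) :
    ∃ e' : ℂ, ∀ z ∈ S, Φ (f^[n] z) = c ^ n * Φ z + e' := by
  induction n with
  | zero => exact ⟨0, fun z _ => by simp⟩
  | succ n ih =>
    obtain ⟨e', h⟩ := ih
    refine ⟨c * e' + e, fun z hz => ?_⟩
    rw [Function.iterate_succ_apply', heq _ (hS.iterate n hz), h z hz]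
    ring

/-- For a solution `Φ` of a functional equation `Φ ∘ f = c Φ + e` on the basin, the claim follows
from a bound for `Φ'' / Φ' ^ 2` along orbits. -/
theorem derivQuotientApprox_of_bound {f : ℂ → ℂ} (hf : MeromorphicNFOn f Set.univ) {p : ℕ}
    (hp : 1 ≤ p) {a : ℂ} (hnc : ∀ z c, ¬ ∀ᶠ w in 𝓝 z, f w = c) (ho : IsOpen (basin f p a))
    {Φ : ℂ → ℂ} (hΦ : DifferentiableOn ℂ Φ (basin f p a)) {c e : ℂ} (hc : c ≠ 0)
    (heq : ∀ z ∈ basin f p a, Φ (f z) = c * Φ z + e) {r : ℕ → ℝ} (hr0 : ∀ n, 0 ≤ r n)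
    (hr1 : ∀ n, r n ≤ 1)
    (hbound : ∀ z ∈ basin f p a, ∃ U ∈ 𝓝 z, ∃ C : ℝ, ∀ᶠ n : ℕ in atTop, ∀ w ∈ U,
      ‖deriv (deriv Φ) (f^[n] w) / deriv Φ (f^[n] w) ^ 2‖ * ‖c‖ ^ n ≤ C * r n)
    {t : ℕ} (ht : 1 ≤ t) :
    DerivQuotientApprox f Φ t r (basin f p a \ {z | deriv Φ z = 0}) := by
  rintro z ⟨hz, hz0⟩
  obtain ⟨U, hU, C, hC⟩ := hbound z hz
  have han := hΦ.analyticOnNhd ho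
  have hcont : ContinuousAt (deriv Φ) z := (han z hz).deriv.continuousAt
  obtain ⟨R, hR, hball⟩ := Metric.mem_nhds_iff.1 (inter_mem (inter_mem hU (ho.mem_nhds hz))
    (inter_mem (hcont.eventually_ne hz0) (hcont.norm.eventually_lt_const
      (lt_add_one ‖deriv Φ z‖))))
  have hfan : ∀ n, ∀ w ∈ Metric.ball z R, AnalyticAt ℂ f^[n] w := fun n w hw =>
    analyticAt_iterate hf (notMem_prePoles_of_mem_fatouSet (hball hw).1.2.1) n
  have hid : ∀ n, ∀ w ∈ Metric.ball z R, deriv f^[n] w ≠ 0 ∧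
      iteratedDeriv 2 f^[n] w / deriv f^[n] w - iteratedDeriv 2 Φ w / deriv Φ w =
      -(deriv (deriv Φ) (f^[n] w) / deriv Φ (f^[n] w) ^ 2) * (c ^ n * deriv Φ w) := by
    intro n w hw
    obtain ⟨e', he'⟩ := exists_iterate_eq (fun z hz => map_mem_basin hf hp hnc hz) heq n
    have hwb := (hball hw).1.2
    exact quotient_sub_quotient_eq (hfan n w hw) (han w hwb)
      (han _ (iterate_mem_basin hf hp hnc hwb n))
      (by filter_upwards [ho.mem_nhds hwb] with y hy using he' y hy) (pow_ne_zero n hc)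
      (hball hw).2.1
  obtain ⟨R', hR', hR'R, C', -, h⟩ := iteratedDeriv_div_deriv_approx (F := fun n => f^[n])
    (C := C * (‖deriv Φ z‖ + 1)) hR hr0 hr1
    (fun w hw => han w (hball hw).1.2) (fun w hw => (hball hw).2.1) (by
      filter_upwards [hC] with n hn
      refine ⟨hfan n, fun w hw => (hid n w hw).1, fun w hw => ?_⟩
      rw [(hid n w hw).2, norm_mul, norm_neg, norm_mul, norm_pow, ← mul_assoc]
      have h1 := hn w (hball hw).1.1
      have h2 : ‖deriv Φ w‖ ≤ ‖deriv Φ z‖ + 1 := (hball hw).2.2.le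
      calc _ ≤ C * r n * (‖deriv Φ z‖ + 1) := by
            gcongr
            exact le_trans (by positivity) h1
        _ = _ := by ring) ht
  refine ⟨Metric.ball z R', mem_nhdsWithin_of_mem_nhds (Metric.ball_mem_nhds z hR'), C', ?_⟩
  filter_upwards [h] with n hn w hw
  exact ⟨(hid n w (Metric.ball_subset_ball hR'R hw)).1, hn w hw⟩

/-! ### The attracting case -/

/-- The basin is open if each of its orbits enters an open set of points converging to `a` under
`f^[p]`: nearby points belong to the Fatou set and enter the same set. -/
theorem isOpen_basin_of_nhds {f : ℂ → ℂ} (hf : MeromorphicNFOn f Set.univ) {p : ℕ} {a : ℂ}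
    (hent : ∀ z ∈ basin f p a, ∃ (V : Set ℂ) (N : ℕ), IsOpen V ∧ f^[N] z ∈ V ∧
      ∀ x ∈ V, Tendsto (fun m : ℕ => f^[p * m] x) atTop (𝓝 a)) : IsOpen (basin f p a) := by
  rw [isOpen_iff_mem_nhds]
  intro z hz
  obtain ⟨V, N, hV, hzV, hlim⟩ := hent z hz
  have hcont := (analyticAt_iterate hf (notMem_prePoles_of_mem_fatouSet hz.1) N).continuousAt
  filter_upwards [(isOpen_fatouSet f).mem_nhds hz.1, hcont (hV.mem_nhds hzV)] with x hxF hxV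
  exact ⟨hxF, N, by simpa only [Function.iterate_add_apply] using hlim _ hxV⟩

/-- Near an attracting fixed point the map is a strict contraction towards it. -/
theorem exists_contraction_ball {g : ℂ → ℂ} {a : ℂ} (hg : DifferentiableAt ℂ g a) (hfix : g a = a)
    (hlam : ‖deriv g a‖ < 1) {V : Set ℂ} (hV : V ∈ 𝓝 a) :
    ∃ ε > 0, ∃ ρ : ℝ, 0 ≤ ρ ∧ ρ < 1 ∧ Metric.ball a ε ⊆ V ∧
      ∀ x ∈ Metric.ball a ε, ∀ m : ℕ, ‖g^[m] x - a‖ ≤ ρ ^ m * ‖x - a‖ := by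
  have h1 := hg.hasDerivAt.isLittleO.def (sub_pos.2 hlam |> half_pos)
  rw [hfix] at h1
  obtain ⟨ε, hε, hball⟩ := Metric.mem_nhds_iff.1 (inter_mem h1 hV)
  set ρ := (1 + ‖deriv g a‖) / 2 with hρ
  have hρ0 : 0 ≤ ρ := by positivity
  have hρ1 : ρ < 1 := by rw [hρ]; linarith
  have hstep : ∀ x ∈ Metric.ball a ε, ‖g x - a‖ ≤ ρ * ‖x - a‖ := by
    intro x hx
    have h2 : ‖g x - a - (x - a) • deriv g a‖ ≤ (1 - ‖deriv g a‖) / 2 * ‖x - a‖ := (hball hx).1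
    have h3 : g x - a = (g x - a - (x - a) • deriv g a) + (x - a) * deriv g a := by
      rw [smul_eq_mul]; ring
    rw [h3]
    refine (norm_add_le _ _).trans ?_
    rw [norm_mul, hρ]
    linarith
  refine ⟨ε, hε, ρ, hρ0, hρ1, fun x hx => (hball hx).2, fun x hx m => ?_⟩
  induction m with
  | zero => simp
  | succ m ih =>
    rw [Function.iterate_succ_apply']
    have hle : ‖g^[m] x - a‖ ≤ ‖x - a‖ :=
      ih.trans (mul_le_of_le_one_left (norm_nonneg _) (pow_le_one₀ hρ0 hρ1.le))
    refine (hstep _ (mem_ball_iff_norm.2 (hle.trans_lt (mem_ball_iff_norm.1 hx)))).trans ?_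
    rw [pow_succ', mul_assoc]
    gcongr

theorem exists_absorbed_ball {f : ℂ → ℂ} (hf : MeromorphicNFOn f Set.univ) {p : ℕ} (hp : 1 ≤ p)
    {a : ℂ} (ha : a ∉ prePoles f) (hfix : f^[p] a = a) (hlam : ‖deriv f^[p] a‖ < 1) :
    ∃ ε > 0, Metric.ball a ε ⊆ (prePoles f)ᶜ ∧
      ∀ V ∈ 𝓝 a, ∀ᶠ m : ℕ in atTop, ∀ x ∈ Metric.ball a ε, f^[p * m] x ∈ V := by
  obtain ⟨ε, hε, ρ, hρ0, hρ1, hsub, h⟩ := exists_contraction_ball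
    (analyticAt_iterate hf ha p).differentiableAt hfix hlam (eventually_analyticAt_orbit hf ha p)
  refine ⟨ε, hε, subset_compl_prePoles_of_mapsTo hp ?_ fun x hx => hsub hx, ?_⟩
  · intro x hx
    have h1 := h x hx 1
    rw [Function.iterate_one, pow_one] at h1
    rw [mem_ball_iff_norm] at hx ⊢
    nlinarith [norm_nonneg (x - a)]
  · intro V hV
    obtain ⟨δ, hδ, hδV⟩ := Metric.mem_nhds_iff.1 hV
    have h1 : Tendsto (fun m : ℕ => ρ ^ m * ε) atTop (𝓝 (0 * ε)) :=
      (tendsto_pow_atTop_nhds_zero_of_lt_one hρ0 hρ1).mul_const ε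
    rw [zero_mul] at h1
    filter_upwards [h1.eventually_lt_const hδ] with m hm x hx
    refine hδV (mem_ball_iff_norm.2 ?_)
    rw [Function.iterate_mul]
    refine (h x hx m).trans_lt (lt_of_le_of_lt ?_ hm)
    have := (mem_ball_iff_norm.1 hx).le
    gcongr

theorem derivQuotientApprox_of_attracting {f : ℂ → ℂ} (hf : MeromorphicNFOn f Set.univ)
    {p : ℕ} (hp : 1 ≤ p) {a : ℂ} (ha : a ∉ prePoles f) (hfix : f^[p] a = a)
    (hlam0 : deriv f^[p] a ≠ 0) (hlam : ‖deriv f^[p] a‖ < 1) {c : ℂ} {Φ : ℂ → ℂ}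
    (hΦ : IsSchroederSolution f p a c Φ) {t : ℕ} (ht : 1 ≤ t) :
    DerivQuotientApprox f Φ t (fun n => ‖deriv f^[p] a‖ ^ ((n : ℝ) / (p : ℝ)))
      (basin f p a \ {z | deriv Φ z = 0}) := by
  have hnc := not_eventually_const hf hp ha hlam0
  obtain ⟨ε, hε, hnp, habs⟩ := exists_absorbed_ball hf hp ha hfix hlam
  have hVb : Metric.ball a ε ⊆ basin f p a :=
    subset_basin_of_absorbed hf hp ha hfix (Nat.zero_le p) Metric.isOpen_ball hnp habs
  have hent : ∀ z ∈ basin f p a, ∃ N : ℕ, f^[N] z ∈ Metric.ball a ε := by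
    rintro z ⟨-, j, hj⟩
    obtain ⟨n, hn⟩ := (hj.eventually (Metric.ball_mem_nhds a hε)).exists
    exact ⟨_, hn⟩
  have ho : IsOpen (basin f p a) := by
    refine isOpen_basin_of_nhds hf fun z hz => ?_
    obtain ⟨N, hN⟩ := hent z hz
    exact ⟨_, N, Metric.isOpen_ball, hN, fun x hx V hV => (habs V hV).mono fun m hm => hm x hx⟩
  have han := hΦ.holo.analyticOnNhd ho
  have hc : c ≠ 0 := by
    rintro rfl
    apply hlam0
    rw [← hΦ.root, zero_pow (by omega)]
  have hr : ∀ n : ℕ, ‖deriv f^[p] a‖ ^ ((n : ℝ) / (p : ℝ)) = ‖c‖ ^ n := by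
    intro n
    have hp0 : (p : ℝ) ≠ 0 := by positivity
    rw [← hΦ.root, norm_pow, ← Real.rpow_natCast, ← Real.rpow_mul (norm_nonneg c),
      mul_div_cancel₀ _ hp0, Real.rpow_natCast]
  have hc1 : ‖c‖ ≤ 1 := by
    rw [← pow_le_one_iff_of_nonneg (norm_nonneg c) (by omega : p ≠ 0), ← norm_pow, hΦ.root]
    exact hlam.le
  simp only [hr]
  refine derivQuotientApprox_of_bound hf hp hnc ho hΦ.holo hc (e := 0)
    (fun z hz => by rw [hΦ.eqn z hz, add_zero]) (fun n => by positivity)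
    (fun n => pow_le_one₀ (norm_nonneg c) hc1) (fun z hz => ?_) ht
  -- `Φ'' / Φ' ^ 2` is bounded near the cycle
  set q : ℂ → ℂ := fun y => deriv (deriv Φ) y / deriv Φ y ^ 2 with hq
  set C := ∑ i ∈ Finset.range p, ‖q (f^[i] a)‖ + 1 with hC
  have ha_mem : a ∈ basin f p a := hVb (Metric.mem_ball_self hε)
  have hnear : ∀ᶠ y in 𝓝 a, ∀ i ∈ Finset.range p, ‖q (f^[i] y)‖ ≤ C := by
    refine (Finset.eventually_all _).2 fun i hi => ?_
    have hmem := iterate_mem_basin hf hp hnc ha_mem i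
    have hqc : ContinuousAt q (f^[i] a) := by
      refine ContinuousAt.div (han _ hmem).deriv.deriv.continuousAt
        ((han _ hmem).deriv.continuousAt.pow 2)
        (pow_ne_zero 2 (hΦ.deriv_ne i (Finset.mem_range.1 hi)))
    have hlt : ‖q (f^[i] a)‖ < C := by
      have := Finset.single_le_sum (f := fun i => ‖q (f^[i] a)‖) (fun _ _ => norm_nonneg _) hi
      linarith
    have h1 := (hqc.norm.comp (f := f^[i])
      (analyticAt_iterate hf ha i).continuousAt).eventually_lt_const hlt
    exact h1.mono fun y hy => hy.le
  obtain ⟨N, hN⟩ := hent z hz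
  have hcont := (analyticAt_iterate hf (notMem_prePoles_of_mem_fatouSet hz.1) N).continuousAt
  refine ⟨_, hcont (Metric.isOpen_ball.mem_nhds hN), C, ?_⟩
  obtain ⟨m₀, hm₀⟩ := eventually_atTop.1 (habs _ hnear)
  filter_upwards [eventually_ge_atTop (N + p * m₀)] with n hn w hw
  have h1 := hm₀ ((n - N) / p) ((Nat.le_div_iff_mul_le hp).2 (by
    rw [mul_comm]; omega)) _ hw ((n - N) % p) (Finset.mem_range.2 (Nat.mod_lt _ hp))
  rw [← Function.iterate_add_apply, ← Function.iterate_add_apply, Nat.mod_add_div,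
    Nat.sub_add_cancel (by omega)] at h1
  gcongr

/-! ### Petals of a germ tangent to the identity -/

/-- The approximate Fatou coordinate `-1 / (k b (z - ζ) ^ k)` at a parabolic fixed point `ζ` of a map
`z + b (z - ζ) ^ (k + 1) + ⋯`; its value at `ζ` itself is `0`. -/
noncomputable def fatouCoord (k : ℕ) (b ζ z : ℂ) : ℂ := -((k : ℂ) * b * (z - ζ) ^ k)⁻¹

/-- The petal for the direction `u`: the points in the sector of opening `π / k` about the
direction `u` that are mapped by the approximate Fatou coordinate into the half-plane `Re > R`. -/
def petal (k : ℕ) (b ζ u : ℂ) (R : ℝ) : Set ℂ :=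
  {z | |Complex.arg ((z - ζ) / u)| < Real.pi / (2 * k) ∧ R < (fatouCoord k b ζ z).re}

theorem norm_fatouCoord (k : ℕ) (b ζ z : ℂ) :
    ‖fatouCoord k b ζ z‖ = (k * ‖b‖ * ‖z - ζ‖ ^ k)⁻¹ := by
  simp [fatouCoord]

theorem fatouCoord_self {k : ℕ} (hk : 1 ≤ k) (b ζ : ℂ) : fatouCoord k b ζ ζ = 0 := by
  simp [fatouCoord, zero_pow (by omega : k ≠ 0)]

theorem fatouCoord_mul {k : ℕ} {b ζ z y ρ : ℂ} (h : y - ζ = (z - ζ) * ρ) :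
    fatouCoord k b ζ y = fatouCoord k b ζ z * (ρ ^ k)⁻¹ := by
  simp only [fatouCoord, h, mul_pow, mul_inv]
  ring

theorem fatouCoord_polar {k : ℕ} {b ζ u : ℂ} {s : ℝ} (hu : u ≠ 0) (hbu : b * u ^ k = -(s : ℂ))
    (z : ℂ) : fatouCoord k b ζ z = (((k * s * ‖(z - ζ) / u‖ ^ k)⁻¹ : ℝ) : ℂ) *
      (Complex.cos ((-(k * Complex.arg ((z - ζ) / u)) : ℝ) : ℂ) +
        Complex.sin ((-(k * Complex.arg ((z - ζ) / u)) : ℝ) : ℂ) * Complex.I) := by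
  set x := (z - ζ) / u with hx
  have h1 : z - ζ = u * x := by rw [hx]; field_simp
  have h2 : x ^ k = ((‖x‖ ^ k : ℝ) : ℂ) * Complex.exp (k * (Complex.arg x * Complex.I)) := by
    conv_lhs => rw [← Complex.norm_mul_exp_arg_mul_I x, mul_pow, ← Complex.exp_nat_mul]
    push_cast; rfl
  rw [← Complex.exp_mul_I, fatouCoord, h1, mul_pow,
    show (k : ℂ) * b * (u ^ k * x ^ k) = k * (b * u ^ k) * x ^ k by ring, hbu, h2]
  have h3 : Complex.exp (((-(k * Complex.arg x) : ℝ) : ℂ) * Complex.I) =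
      (Complex.exp (k * (Complex.arg x * Complex.I)))⁻¹ := by
    rw [← Complex.exp_neg]; congr 1; push_cast; ring
  rw [h3]
  push_cast
  simp only [mul_inv, inv_neg]
  ring

theorem fatouCoord_re {k : ℕ} {b ζ u : ℂ} {s : ℝ} (hu : u ≠ 0) (hbu : b * u ^ k = -(s : ℂ))
    (z : ℂ) : (fatouCoord k b ζ z).re =
      (k * s * ‖(z - ζ) / u‖ ^ k)⁻¹ * Real.cos (k * Complex.arg ((z - ζ) / u)) := by
  rw [fatouCoord_polar hu hbu, ← Complex.ofReal_cos, ← Complex.ofReal_sin, Complex.re_ofReal_mul,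
    Complex.add_re, Complex.ofReal_re, Complex.re_ofReal_mul, Complex.I_re, mul_zero, add_zero,
    Real.cos_neg]

theorem arg_fatouCoord {k : ℕ} (hk : 1 ≤ k) {b ζ u z : ℂ} {s : ℝ} (hs : 0 < s) (hu : u ≠ 0)
    (hbu : b * u ^ k = -(s : ℂ)) (hz : z ≠ ζ)
    (harg : |Complex.arg ((z - ζ) / u)| < Real.pi / (2 * k)) :
    Complex.arg (fatouCoord k b ζ z) = -(k * Complex.arg ((z - ζ) / u)) := by
  have hk0 : (0 : ℝ) < k := by exact_mod_cast hk
  have hx : 0 < ‖(z - ζ) / u‖ := norm_pos_iff.2 (div_ne_zero (sub_ne_zero.2 hz) hu)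
  rw [fatouCoord_polar hu hbu]
  rw [lt_div_iff₀ (by positivity)] at harg
  have h1 := abs_lt.1 (show |k * Complex.arg ((z - ζ) / u)| < Real.pi by
    rw [abs_mul, abs_of_pos hk0]; nlinarith [Real.pi_pos])
  exact Complex.arg_mul_cos_add_sin_mul_I (by positivity) ⟨by linarith, by linarith⟩

/-- A small rotation cannot leave the sector `|arg| < π / (2k)` without entering the region where
the `k`-th power has non-positive real part. -/
theorem abs_arg_mul_lt {k : ℕ} (hk : 1 ≤ k) {x ρ : ℂ} (hx : x ≠ 0) (hρ : ρ ≠ 0)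
    (h1 : |Complex.arg x| < Real.pi / (2 * k)) (h2 : |Complex.arg ρ| < Real.pi / (2 * k))
    (hcos : 0 < Real.cos (k * Complex.arg (x * ρ))) :
    |Complex.arg (x * ρ)| < Real.pi / (2 * k) := by
  have hk1 : (1 : ℝ) ≤ k := by exact_mod_cast hk
  rw [lt_div_iff₀ (by positivity)] at h1 h2 ⊢
  have hsum : |Complex.arg x + Complex.arg ρ| * k < Real.pi := by
    have := abs_add_le (Complex.arg x) (Complex.arg ρ)
    nlinarith
  have hsum' : |Complex.arg x + Complex.arg ρ| < Real.pi := by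
    nlinarith [abs_nonneg (Complex.arg x + Complex.arg ρ)]
  have harg : Complex.arg (x * ρ) = Complex.arg x + Complex.arg ρ :=
    Complex.arg_mul hx hρ ⟨(abs_lt.1 hsum').1, (abs_lt.1 hsum').2.le⟩
  rw [← harg] at hsum
  by_contra! hcon
  refine absurd hcos (not_lt.2 ?_)
  rw [← Real.cos_abs, abs_mul, abs_of_pos (by linarith : (0 : ℝ) < k)]
  exact Real.cos_nonpos_of_pi_div_two_le_of_le (by linarith) (by linarith)

/-- The criterion for staying in a petal: a small rotation about `ζ` that keeps the approximate
Fatou coordinate in the half-plane. -/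
theorem mem_petal_of_mul {k : ℕ} (hk : 1 ≤ k) {b ζ u z y ρ : ℂ} {s R : ℝ} (hs : 0 < s) (hu : u ≠ 0)
    (hbu : b * u ^ k = -(s : ℂ)) (hR : 0 ≤ R) (hz : z ∈ petal k b ζ u R) (hzζ : z ≠ ζ)
    (hρ : ρ ≠ 0) (harg : |Complex.arg ρ| < Real.pi / (2 * k)) (hy : y - ζ = (z - ζ) * ρ)
    (hre : R < (fatouCoord k b ζ y).re) : y ∈ petal k b ζ u R := by
  refine ⟨?_, hre⟩
  have e : (y - ζ) / u = (z - ζ) / u * ρ := by rw [hy]; ring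
  have h1 : 0 < (fatouCoord k b ζ y).re := hR.trans_lt hre
  rw [fatouCoord_re hu hbu] at h1
  rw [e] at h1 ⊢
  exact abs_arg_mul_lt hk (div_ne_zero (sub_ne_zero.2 hzζ) hu) hρ hz.1 harg
    (pos_of_mul_pos_right h1 (by positivity))

theorem continuousAt_fatouCoord {k : ℕ} {b ζ z : ℂ} (hk : 1 ≤ k) (hb : b ≠ 0) (hz : z ≠ ζ) :
    ContinuousAt (fatouCoord k b ζ) z := by
  have h : (k : ℂ) * b * (z - ζ) ^ k ≠ 0 :=
    mul_ne_zero (mul_ne_zero (by exact_mod_cast (by omega : k ≠ 0)) hb)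
      (pow_ne_zero _ (sub_ne_zero.2 hz))
  exact ((by fun_prop : ContinuousAt (fun z => (k : ℂ) * b * (z - ζ) ^ k) z).inv₀ h).neg

theorem ne_of_re_fatouCoord_pos {k : ℕ} (hk : 1 ≤ k) {b ζ z : ℂ}
    (h : 0 < (fatouCoord k b ζ z).re) : z ≠ ζ := by
  rintro rfl
  simp [fatouCoord_self hk] at h

theorem isOpen_petal {k : ℕ} (hk : 1 ≤ k) {b ζ u : ℂ} (hb : b ≠ 0) (hu : u ≠ 0) {R : ℝ}
    (hR : 0 ≤ R) : IsOpen (petal k b ζ u R) := by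
  rw [isOpen_iff_mem_nhds]
  rintro z ⟨h1, h2⟩
  have hz := ne_of_re_fatouCoord_pos hk (hR.trans_lt h2)
  have hk1 : (1 : ℝ) ≤ k := by exact_mod_cast hk
  have hslit : (z - ζ) / u ∈ Complex.slitPlane := by
    refine Complex.mem_slitPlane_iff_arg.2 ⟨fun h => ?_, div_ne_zero (sub_ne_zero.2 hz) hu⟩
    rw [h, abs_of_pos Real.pi_pos, lt_div_iff₀ (by positivity)] at h1
    nlinarith [Real.pi_pos]
  have hc : ContinuousAt (fun z => |Complex.arg ((z - ζ) / u)|) z :=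
    ((Complex.continuousAt_arg hslit).comp (f := fun z => (z - ζ) / u) (by fun_prop)).abs
  have hc2 : ContinuousAt (fun z => (fatouCoord k b ζ z).re) z :=
    Complex.continuous_re.continuousAt.comp (continuousAt_fatouCoord hk hb hz)
  exact (hc.eventually_lt_const h1).and (hc2.eventually_const_lt h2)

/-- Points with a large approximate Fatou coordinate are close to the fixed point. -/
theorem norm_sub_lt_of_lt_norm_fatouCoord {k : ℕ} (hk : 1 ≤ k) {b ζ z : ℂ} (hb : b ≠ 0) {δ : ℝ}
    (hδ : 0 < δ) (h : (k * ‖b‖ * δ ^ k)⁻¹ < ‖fatouCoord k b ζ z‖) : ‖z - ζ‖ < δ := by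
  have hk0 : (0 : ℝ) < k := by exact_mod_cast hk
  have hb0 := norm_pos_iff.2 hb
  rw [norm_fatouCoord] at h
  by_contra! hcon
  refine absurd h (not_lt.2 ?_)
  gcongr

/-- Every point with positive real part of the approximate Fatou coordinate lies in the sector of
some attracting direction. -/
theorem exists_direction {k : ℕ} (hk : 1 ≤ k) {b ζ z : ℂ} {R : ℝ} (hR : 0 ≤ R)
    (h : R < (fatouCoord k b ζ z).re) :
    ∃ u : ℂ, ‖u‖ = 1 ∧ (∃ s : ℝ, 0 < s ∧ b * u ^ k = -(s : ℂ)) ∧ z ∈ petal k b ζ u R := by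
  set W := fatouCoord k b ζ z with hW
  have hWre : 0 < W.re := hR.trans_lt h
  have hz := ne_of_re_fatouCoord_pos hk hWre
  have hk0 : (0 : ℝ) < k := by exact_mod_cast hk
  have hkC : (k : ℂ) ≠ 0 := by exact_mod_cast hk0.ne'
  have hv : z - ζ ≠ 0 := sub_ne_zero.2 hz
  have hn : 0 < ‖z - ζ‖ := norm_pos_iff.2 hv
  have hnC : ((‖z - ζ‖ : ℝ) : ℂ) ≠ 0 := by exact_mod_cast hn.ne'
  have hW0 : W ≠ 0 := by rintro h0; rw [h0] at hWre; simp at hWre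
  have hWn : 0 < ‖W‖ := norm_pos_iff.2 hW0
  have hWnC : ((‖W‖ : ℝ) : ℂ) ≠ 0 := by exact_mod_cast hWn.ne'
  set θ := Complex.arg W with hθ
  have hθlt : |θ| < Real.pi / 2 := Complex.abs_arg_lt_pi_div_two_iff.2 (Or.inl hWre)
  set E := Complex.exp (((θ / k : ℝ) : ℂ) * Complex.I) with hE
  have hE0 : E ≠ 0 := Complex.exp_ne_zero _
  have hEk : E ^ k = Complex.exp (θ * Complex.I) := by
    rw [hE, ← Complex.exp_nat_mul]
    congr 1
    push_cast
    field_simp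
  have hWE : W = ‖W‖ * E ^ k := by rw [hEk]; exact (Complex.norm_mul_exp_arg_mul_I W).symm
  have hbv : b * (z - ζ) ^ k = -(k * W)⁻¹ := by
    have : W = -((k : ℂ) * b * (z - ζ) ^ k)⁻¹ := rfl
    rw [this]
    field_simp
  have hEn : ‖E‖ = 1 := Complex.norm_exp_ofReal_mul_I _
  refine ⟨(z - ζ) / ‖z - ζ‖ * E, ?_, ⟨(k * ‖W‖ * ‖z - ζ‖ ^ k)⁻¹, by positivity, ?_⟩, ?_, h⟩
  · rw [norm_mul, norm_div, Complex.norm_real, norm_norm, div_self hn.ne', hEn, one_mul]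
  · rw [mul_pow, div_pow, ← mul_assoc, mul_div_assoc', hbv, hWE]
    push_cast
    rw [norm_mul, norm_pow, hEn]
    simp only [one_pow, mul_one, Complex.norm_real, norm_norm]
    field_simp
  · have e : (z - ζ) / ((z - ζ) / ‖z - ζ‖ * E) = (‖z - ζ‖ : ℝ) *
        (Complex.cos ((-(θ / k) : ℝ) : ℂ) + Complex.sin ((-(θ / k) : ℝ) : ℂ) * Complex.I) := by
      rw [← Complex.exp_mul_I]
      have : Complex.exp (((-(θ / k) : ℝ) : ℂ) * Complex.I) = E⁻¹ := by
        rw [hE, ← Complex.exp_neg]; congr 1; push_cast; ring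
      rw [this]
      field_simp
    have hlt : |θ / k| < Real.pi / (2 * k) := by
      rw [abs_div, abs_of_pos hk0, ← div_div]
      gcongr
    have hpi : |θ / k| < Real.pi := hlt.trans_le (by
      rw [div_le_iff₀ (by positivity)]
      have hk1 : (1 : ℝ) ≤ k := by exact_mod_cast hk
      nlinarith [Real.pi_pos])
    rw [e, Complex.arg_mul_cos_add_sin_mul_I hn
      ⟨by linarith [(abs_lt.1 hpi).2], by linarith [(abs_lt.1 hpi).1]⟩, abs_neg]
    exact hlt

/-- The local properties of a map tangent to the identity to order `k + 1` at `ζ` that govern its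
dynamics on the disc of radius `δ`: in the approximate Fatou coordinate it is close to the
translation by `1`. -/
structure IsParabolicOn (g : ℂ → ℂ) (k : ℕ) (b ζ : ℂ) (δ : ℝ) : Prop where
  one_le : 1 ≤ k
  coeff_ne : b ≠ 0
  pos : 0 < δ
  map_ne : ∀ z, z ≠ ζ → ‖z - ζ‖ < δ → g z ≠ ζ
  step : ∀ z, z ≠ ζ → ‖z - ζ‖ < δ → ‖fatouCoord k b ζ (g z) - fatouCoord k b ζ z - 1‖ ≤ 1 / 4
  abs_arg : ∀ z, z ≠ ζ → ‖z - ζ‖ < δ → |Complex.arg ((g z - ζ) / (z - ζ))| < Real.pi / (2 * k)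
  norm_sub : ∀ z, z ≠ ζ → ‖z - ζ‖ < δ → ‖g z - z‖ ≤ 2 * ‖b‖ * ‖z - ζ‖ ^ (k + 1)
  injOn : Set.InjOn g (Metric.ball ζ δ)
  tendsto : Tendsto (fun z => fatouCoord k b ζ (g z) - fatouCoord k b ζ z) (𝓝[≠] ζ) (𝓝 1)

theorem tendsto_fatouCoord_sub {g : ℂ → ℂ} {k : ℕ} (hk : 1 ≤ k) {b ζ : ℂ} (hb : b ≠ 0)
    (hg : (fun z => g z - z - b * (z - ζ) ^ (k + 1)) =o[𝓝 ζ] fun z => (z - ζ) ^ (k + 1)) :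
    Tendsto (fun z => (g z - z) / (z - ζ) ^ (k + 1)) (𝓝[≠] ζ) (𝓝 b) ∧
    Tendsto (fun z => (g z - ζ) / (z - ζ)) (𝓝[≠] ζ) (𝓝 1) ∧
    Tendsto (fun z => fatouCoord k b ζ (g z) - fatouCoord k b ζ z) (𝓝[≠] ζ) (𝓝 1) := by
  have hkC : (k : ℂ) ≠ 0 := by exact_mod_cast (by omega : k ≠ 0)
  have hne : ∀ᶠ z in 𝓝[≠] ζ, z - ζ ≠ 0 := by
    filter_upwards [self_mem_nhdsWithin] with z hz using sub_ne_zero.2 hz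
  have h1 : Tendsto (fun z => (g z - z) / (z - ζ) ^ (k + 1)) (𝓝[≠] ζ) (𝓝 b) := by
    have h2 := (hg.mono nhdsWithin_le_nhds : _ =o[𝓝[≠] ζ] _).tendsto_div_nhds_zero.add_const b
    rw [zero_add] at h2
    refine h2.congr' ?_
    filter_upwards [hne] with z hz
    field_simp
    ring
  have hsub : Tendsto (fun z : ℂ => (z - ζ) ^ k) (𝓝[≠] ζ) (𝓝 0) := by
    have : ContinuousAt (fun z : ℂ => (z - ζ) ^ k) ζ := by fun_prop
    have h2 := this.tendsto.mono_left (nhdsWithin_le_nhds (s := {ζ}ᶜ))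
    simpa [zero_pow (by omega : k ≠ 0)] using h2
  have hε : Tendsto (fun z => (g z - z) / (z - ζ)) (𝓝[≠] ζ) (𝓝 0) := by
    have h2 := h1.mul hsub
    rw [mul_zero] at h2
    refine h2.congr' ?_
    filter_upwards [hne] with z hz
    field_simp
    ring
  have hq : Tendsto (fun z => (g z - ζ) / (z - ζ)) (𝓝[≠] ζ) (𝓝 1) := by
    have h2 := hε.add_const 1
    rw [zero_add] at h2
    refine h2.congr' ?_
    filter_upwards [hne] with z hz
    field_simp
    ring
  refine ⟨h1, hq, ?_⟩
  -- the difference quotient of `(1 + ε) ^ (-k)` at `ε = 0` tends to `-k`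
  set φ : ℂ → ℂ := fun e => ((1 + e) ^ k)⁻¹ with hφ
  have hder : HasDerivAt φ (-k : ℂ) 0 := by
    have h2 := (((hasDerivAt_id (0 : ℂ)).const_add 1).pow k).inv (by simp)
    refine h2.congr_deriv ?_
    simp
  have hds : Tendsto (dslope φ 0) (𝓝 0) (𝓝 (-k)) := by
    have h2 := (continuousAt_dslope_same.2 hder.differentiableAt).tendsto
    rwa [dslope_same, hder.deriv] at h2
  have h3 := (h1.mul (hds.comp hε)).const_mul (-(k * b)⁻¹)
  have e1 : -((k : ℂ) * b)⁻¹ * (b * -k) = 1 := by field_simp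
  rw [e1] at h3
  refine h3.congr' ?_
  filter_upwards [hne] with z hz
  have h4 : g z - ζ = (z - ζ) * (1 + (g z - z) / (z - ζ)) := by field_simp; ring
  have h5 := sub_smul_dslope φ 0 ((g z - z) / (z - ζ))
  rw [sub_zero, smul_eq_mul] at h5
  have h6 : φ 0 = 1 := by simp [hφ]
  rw [fatouCoord_mul h4, ← mul_sub_one]
  change _ = fatouCoord k b ζ z * (φ ((g z - z) / (z - ζ)) - 1)
  rw [← h6, ← h5, fatouCoord, Function.comp_apply]
  field_simp
  ring

theorem exists_isParabolicOn {g : ℂ → ℂ} {k : ℕ} (hk : 1 ≤ k) {b ζ : ℂ} (hb : b ≠ 0)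
    (hg : (fun z => g z - z - b * (z - ζ) ^ (k + 1)) =o[𝓝 ζ] fun z => (z - ζ) ^ (k + 1))
    (hd : HasStrictDerivAt g 1 ζ) {V : Set ℂ} (hV : V ∈ 𝓝 ζ) :
    ∃ δ, IsParabolicOn g k b ζ δ ∧ Metric.ball ζ δ ⊆ V := by
  obtain ⟨h1, h2, h3⟩ := tendsto_fatouCoord_sub hk hb hg
  have hk0 : (0 : ℝ) < k := by exact_mod_cast hk
  have hb0 := norm_pos_iff.2 hb
  have harg : Tendsto (fun z => |Complex.arg ((g z - ζ) / (z - ζ))|) (𝓝[≠] ζ) (𝓝 0) := by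
    have := ((Complex.continuousAt_arg Complex.one_mem_slitPlane).tendsto.comp h2).abs
    simpa using this
  have hev := (((h2.eventually_ne one_ne_zero).and
    (((h3.sub_const 1).norm.eventually_le_const (u := 1 / 4) (by simp)))).and
    ((harg.eventually_lt_const (u := Real.pi / (2 * k)) (by positivity)).and
    (h1.norm.eventually_le_const (u := 2 * ‖b‖) (by linarith))))
  rw [eventually_nhdsWithin_iff] at hev
  have hinj := hd.eventually_left_inverse one_ne_zero
  obtain ⟨δ, hδ, hball⟩ := Metric.mem_nhds_iff.1 (inter_mem (inter_mem hev hinj) hV)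
  have hmem : ∀ z, z ≠ ζ → ‖z - ζ‖ < δ → _ := fun z hz hzδ =>
    (hball (mem_ball_iff_norm.2 hzδ)).1.1 hz
  refine ⟨δ, ⟨hk, hb, hδ, ?_, fun z hz hzδ => (hmem z hz hzδ).1.2,
    fun z hz hzδ => (hmem z hz hzδ).2.1, ?_, ?_, h3⟩, fun z hz => (hball hz).2⟩
  · intro z hz hzδ h0
    apply (hmem z hz hzδ).1.1
    rw [h0, sub_self, zero_div]
  · intro z hz hzδ
    have h4 := (hmem z hz hzδ).2.2
    have h5 : 0 < ‖z - ζ‖ := norm_pos_iff.2 (sub_ne_zero.2 hz)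
    rwa [norm_div, norm_pow, div_le_iff₀ (by positivity)] at h4
  · intro x hx y hy e
    have hx' : _ = x := (hball hx).1.2
    have hy' : _ = y := (hball hy).1.2
    rw [← hx', ← hy', e]

/-! ### Orbits in petals -/

section

variable {g : ℂ → ℂ} {k : ℕ} {b ζ u : ℂ} {δ R s : ℝ}

theorem IsParabolicOn.near (hg : IsParabolicOn g k b ζ δ) (hR : (k * ‖b‖ * δ ^ k)⁻¹ ≤ R) {z : ℂ}
    (hz : R < (fatouCoord k b ζ z).re) : z ≠ ζ ∧ ‖z - ζ‖ < δ := by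
  have hδ := hg.pos
  have h0 : (0 : ℝ) ≤ (k * ‖b‖ * δ ^ k)⁻¹ := by positivity
  exact ⟨ne_of_re_fatouCoord_pos hg.one_le ((h0.trans hR).trans_lt hz),
    norm_sub_lt_of_lt_norm_fatouCoord hg.one_le hg.coeff_ne hδ
      (hR.trans_lt (hz.trans_le (Complex.re_le_norm _)))⟩

theorem IsParabolicOn.re_map (hg : IsParabolicOn g k b ζ δ) {z : ℂ} (hz : z ≠ ζ)
    (hzδ : ‖z - ζ‖ < δ) : (fatouCoord k b ζ z).re + 3 / 4 ≤ (fatouCoord k b ζ (g z)).re := by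
  have h1 := (abs_le.1 ((Complex.abs_re_le_norm _).trans (hg.step z hz hzδ))).1
  simp only [Complex.sub_re, Complex.one_re] at h1
  linarith

theorem IsParabolicOn.mapsTo_petal (hg : IsParabolicOn g k b ζ δ) (hs : 0 < s) (hu : u ≠ 0)
    (hbu : b * u ^ k = -(s : ℂ)) (hR : (k * ‖b‖ * δ ^ k)⁻¹ ≤ R) :
    Set.MapsTo g (petal k b ζ u R) (petal k b ζ u R) := by
  intro z hz
  have hδ := hg.pos
  have h0 : (0 : ℝ) ≤ (k * ‖b‖ * δ ^ k)⁻¹ := by positivity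
  obtain ⟨hzζ, hzδ⟩ := hg.near hR hz.2
  have hv := sub_ne_zero.2 hzζ
  refine mem_petal_of_mul hg.one_le hs hu hbu (h0.trans hR) hz hzζ (ρ := (g z - ζ) / (z - ζ))
    (div_ne_zero (sub_ne_zero.2 (hg.map_ne z hzζ hzδ)) hv) (hg.abs_arg z hzζ hzδ)
    (by field_simp) ?_
  linarith [hg.re_map hzζ hzδ, hz.2]

theorem IsParabolicOn.norm_iterate_sub_le (hg : IsParabolicOn g k b ζ δ) (hs : 0 < s) (hu : u ≠ 0)
    (hbu : b * u ^ k = -(s : ℂ)) (hR : (k * ‖b‖ * δ ^ k)⁻¹ ≤ R) {z : ℂ}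
    (hz : z ∈ petal k b ζ u R) (n : ℕ) :
    ‖fatouCoord k b ζ (g^[n] z) - fatouCoord k b ζ z - n‖ ≤ n / 4 := by
  induction n with
  | zero => simp
  | succ n ih =>
    obtain ⟨hzζ, hzδ⟩ := hg.near hR ((hg.mapsTo_petal hs hu hbu hR).iterate n hz).2
    rw [Function.iterate_succ_apply']
    have h1 := hg.step _ hzζ hzδ
    have e : fatouCoord k b ζ (g (g^[n] z)) - fatouCoord k b ζ z - (n + 1 : ℕ) =
      (fatouCoord k b ζ (g^[n] z) - fatouCoord k b ζ z - n) +
      (fatouCoord k b ζ (g (g^[n] z)) - fatouCoord k b ζ (g^[n] z) - 1) := by push_cast; ring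
    rw [e]
    refine (norm_add_le _ _).trans ?_
    push_cast
    linarith

theorem IsParabolicOn.lt_re_iterate (hg : IsParabolicOn g k b ζ δ) (hs : 0 < s) (hu : u ≠ 0)
    (hbu : b * u ^ k = -(s : ℂ)) (hR : (k * ‖b‖ * δ ^ k)⁻¹ ≤ R) {z : ℂ}
    (hz : z ∈ petal k b ζ u R) (n : ℕ) :
    (fatouCoord k b ζ z).re + 3 / 4 * n ≤ (fatouCoord k b ζ (g^[n] z)).re := by
  have h1 := (abs_le.1 ((Complex.abs_re_le_norm _).trans
    (hg.norm_iterate_sub_le hs hu hbu hR hz n))).1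
  simp only [Complex.sub_re, Complex.natCast_re] at h1
  linarith

/-- The petal is uniformly absorbed by the fixed point. -/
theorem IsParabolicOn.eventually_mem (hg : IsParabolicOn g k b ζ δ) (hs : 0 < s) (hu : u ≠ 0)
    (hbu : b * u ^ k = -(s : ℂ)) (hR : (k * ‖b‖ * δ ^ k)⁻¹ ≤ R) {V : Set ℂ} (hV : V ∈ 𝓝 ζ) :
    ∀ᶠ n : ℕ in atTop, ∀ x ∈ petal k b ζ u R, g^[n] x ∈ V := by
  obtain ⟨ε, hε, hball⟩ := Metric.mem_nhds_iff.1 hV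
  have hδ := hg.pos
  have h0 : (0 : ℝ) ≤ (k * ‖b‖ * δ ^ k)⁻¹ := by positivity
  have hlim : Tendsto (fun n : ℕ => 3 / 4 * (n : ℝ)) atTop atTop :=
    tendsto_natCast_atTop_atTop.const_mul_atTop (by norm_num)
  filter_upwards [hlim.eventually_gt_atTop (k * ‖b‖ * ε ^ k)⁻¹] with n hn x hx
  refine hball (mem_ball_iff_norm.2
    (norm_sub_lt_of_lt_norm_fatouCoord hg.one_le hg.coeff_ne hε (hn.trans_le ?_)))
  refine le_trans ?_ (Complex.re_le_norm _)
  linarith [hg.lt_re_iterate hs hu hbu hR hx n, hx.2]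

theorem IsParabolicOn.tendsto_iterate (hg : IsParabolicOn g k b ζ δ) (hs : 0 < s) (hu : u ≠ 0)
    (hbu : b * u ^ k = -(s : ℂ)) (hR : (k * ‖b‖ * δ ^ k)⁻¹ ≤ R) {z : ℂ}
    (hz : z ∈ petal k b ζ u R) : Tendsto (fun n => g^[n] z) atTop (𝓝 ζ) := fun _ hV =>
  (hg.eventually_mem hs hu hbu hR hV).mono fun _ hn => hn z hz

/-- Orbits in a petal converge from the direction of the petal: by Cesàro's theorem, the approximate
Fatou coordinate of the `n`-th point is asymptotic to `n`, so that its argument tends to `0`. -/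
theorem IsParabolicOn.convergesFrom (hg : IsParabolicOn g k b ζ δ) (hs : 0 < s) (hu : ‖u‖ = 1)
    (hbu : b * u ^ k = -(s : ℂ)) (hR : (k * ‖b‖ * δ ^ k)⁻¹ ≤ R) {z : ℂ}
    (hz : z ∈ petal k b ζ u R) : ConvergesFrom (fun n => g^[n] z) ζ u := by
  have hu0 : u ≠ 0 := norm_ne_zero_iff.1 (by rw [hu]; exact one_ne_zero)
  have hk0 : (0 : ℝ) < k := by exact_mod_cast hg.one_le
  have hlim := hg.tendsto_iterate hs hu0 hbu hR hz
  refine ⟨hlim, ?_⟩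
  have hmem : ∀ n, g^[n] z ∈ petal k b ζ u R := fun n =>
    (hg.mapsTo_petal hs hu0 hbu hR).iterate n hz
  have hne : ∀ n, g^[n] z ≠ ζ := fun n => (hg.near hR (hmem n).2).1
  set W : ℕ → ℂ := fun n => fatouCoord k b ζ (g^[n] z) with hW
  have hstep : Tendsto (fun n => W (n + 1) - W n) atTop (𝓝 1) := by
    have h1 := hg.tendsto.comp (tendsto_nhdsWithin_iff.2 ⟨hlim, Eventually.of_forall hne⟩)
    refine h1.congr fun n => ?_
    simp only [hW, Function.comp_apply, Function.iterate_succ_apply']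
  have hces := hstep.cesaro_smul
  have hWn : Tendsto (fun n : ℕ => ((n : ℝ)⁻¹ : ℝ) • W n) atTop (𝓝 1) := by
    have h0 : Tendsto (fun n : ℕ => ((n : ℝ)⁻¹ : ℝ) • W 0) atTop (𝓝 ((0 : ℝ) • W 0)) :=
      tendsto_inv_atTop_nhds_zero_nat.smul_const _
    have h1 := hces.add h0
    rw [zero_smul, add_zero] at h1
    refine h1.congr fun n => ?_
    rw [Finset.sum_range_sub, ← smul_add, sub_add_cancel]
  have hargW : Tendsto (fun n => Complex.arg (W n)) atTop (𝓝 0) := by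
    have h1 := (Complex.continuousAt_arg Complex.one_mem_slitPlane).tendsto.comp hWn
    rw [Complex.arg_one] at h1
    refine h1.congr' ?_
    filter_upwards [eventually_gt_atTop 0] with n hn
    have : (0 : ℝ) < (n : ℝ)⁻¹ := by positivity
    rw [Function.comp_apply, Complex.real_smul, Complex.arg_real_mul _ this]
  have hargx : Tendsto (fun n => Complex.arg ((g^[n] z - ζ) / u)) atTop (𝓝 0) := by
    have h1 := hargW.const_mul (-(k : ℝ)⁻¹)
    rw [mul_zero] at h1
    refine h1.congr fun n => ?_
    rw [hW]
    simp only
    rw [arg_fatouCoord hg.one_le hs hu0 hbu (hne n) (hmem n).1]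
    field_simp
  have hexp : Tendsto (fun n => u * Complex.exp ((Complex.arg ((g^[n] z - ζ) / u) : ℝ) * Complex.I))
      atTop (𝓝 u) := by
    have h1 : Continuous fun t : ℝ => u * Complex.exp ((t : ℂ) * Complex.I) := by fun_prop
    have h2 := (h1.tendsto 0).comp hargx
    simpa [Function.comp_def] using h2
  refine hexp.congr fun n => ?_
  have hv : ((‖g^[n] z - ζ‖ : ℝ) : ℂ) ≠ 0 := by
    exact_mod_cast norm_ne_zero_iff.2 (sub_ne_zero.2 (hne n))
  have h3 := Complex.norm_mul_exp_arg_mul_I ((g^[n] z - ζ) / u)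
  rw [norm_div, hu, div_one] at h3
  rw [eq_div_iff hv, mul_assoc, mul_comm (Complex.exp _), h3]
  field_simp

/-- A sequence that converges to `ζ` from the direction `u` is eventually in the petal. -/
theorem ConvergesFrom.eventually_mem_petal {x : ℕ → ℂ} (hx : ConvergesFrom x ζ u) (hk : 1 ≤ k)
    (hs : 0 < s) (hu : ‖u‖ = 1) (hbu : b * u ^ k = -(s : ℂ)) (R : ℝ) :
    ∀ᶠ n in atTop, x n ∈ petal k b ζ u R := by
  obtain ⟨hlim, hdir⟩ := hx
  have hu0 : u ≠ 0 := norm_ne_zero_iff.1 (by rw [hu]; exact one_ne_zero)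
  have hk0 : (0 : ℝ) < k := by exact_mod_cast hk
  have hne : ∀ᶠ n in atTop, x n ≠ ζ := by
    filter_upwards [hdir.eventually_ne hu0] with n hn h0
    rw [h0] at hn
    simp at hn
  have harg : Tendsto (fun n => Complex.arg ((x n - ζ) / u)) atTop (𝓝 0) := by
    have h1 := hdir.div_const u
    rw [div_self hu0] at h1
    have h2 := (Complex.continuousAt_arg Complex.one_mem_slitPlane).tendsto.comp h1
    rw [Complex.arg_one] at h2
    refine h2.congr' ?_
    filter_upwards [hne] with n hn
    have h3 : 0 < ‖x n - ζ‖⁻¹ := inv_pos.2 (norm_pos_iff.2 (sub_ne_zero.2 hn))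
    rw [Function.comp_apply, ← Complex.arg_real_mul ((x n - ζ) / u) h3]
    congr 1
    push_cast
    field_simp
  have hcos : Tendsto (fun n => Real.cos (k * Complex.arg ((x n - ζ) / u))) atTop (𝓝 1) := by
    have h1 : Continuous fun t : ℝ => Real.cos (k * t) := by fun_prop
    simpa [Function.comp_def] using (h1.tendsto 0).comp harg
  have hnorm : Tendsto (fun n => k * s * ‖(x n - ζ) / u‖ ^ k) atTop (𝓝[>] 0) := by
    refine tendsto_nhdsWithin_iff.2 ⟨?_, ?_⟩
    · have h1 : Continuous fun z : ℂ => k * s * ‖(z - ζ) / u‖ ^ k := by fun_prop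
      have h2 := (h1.tendsto ζ).comp hlim
      simpa [Function.comp_def, zero_pow (by omega : k ≠ 0)] using h2
    · filter_upwards [hne] with n hn
      have : 0 < ‖(x n - ζ) / u‖ := norm_pos_iff.2 (div_ne_zero (sub_ne_zero.2 hn) hu0)
      exact Set.mem_Ioi.2 (by positivity)
  have hre := (tendsto_inv_nhdsGT_zero.comp hnorm).atTop_mul_pos one_pos hcos
  have habs := harg.abs
  rw [abs_zero] at habs
  filter_upwards [habs.eventually_lt_const (u := Real.pi / (2 * k)) (by positivity),
    hre.eventually_gt_atTop R] with n h1 h2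
  refine ⟨h1, ?_⟩
  rw [fatouCoord_re hu0 hbu]
  exact h2

/-- An orbit that converges to the parabolic fixed point without reaching it enters a petal. -/
theorem IsParabolicOn.exists_mem_petal (hg : IsParabolicOn g k b ζ δ) (hR0 : 0 ≤ R) {z : ℂ}
    (hne : ∀ n, g^[n] z ≠ ζ) (hlim : Tendsto (fun n => g^[n] z) atTop (𝓝 ζ)) :
    ∃ (N : ℕ) (u : ℂ), ‖u‖ = 1 ∧ (∃ s : ℝ, 0 < s ∧ b * u ^ k = -(s : ℂ)) ∧
      g^[N] z ∈ petal k b ζ u R := by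
  obtain ⟨N, hN⟩ := eventually_atTop.1 (hlim.eventually (Metric.ball_mem_nhds ζ hg.pos))
  have hre : ∀ m : ℕ, (fatouCoord k b ζ (g^[N] z)).re + 3 / 4 * m ≤
      (fatouCoord k b ζ (g^[N + m] z)).re := by
    intro m
    induction m with
    | zero => simp
    | succ m ih =>
      have h1 := hg.re_map (hne (N + m)) (mem_ball_iff_norm.1 (hN _ (Nat.le_add_right _ _)))
      rw [← Function.iterate_succ_apply' g] at h1
      rw [← add_assoc]
      push_cast
      linarith
  obtain ⟨m, hm⟩ := exists_nat_gt ((R - (fatouCoord k b ζ (g^[N] z)).re) * (4 / 3))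
  have hlt : R < (fatouCoord k b ζ (g^[N + m] z)).re := by
    have := hre m
    linarith
  obtain ⟨u, hu, hs, hmem⟩ := exists_direction hg.one_le hR0 hlt
  exact ⟨N + m, u, hu, hs, hmem⟩

/-- Deep points of a petal are centres of discs in the petal, of radius comparable to their distance
from the fixed point. -/
theorem exists_ball_subset_petal (hk : 1 ≤ k) (b ζ : ℂ) :
    ∃ κ : ℝ, 0 < κ ∧ ∀ {u : ℂ} {s R : ℝ}, 0 < s → u ≠ 0 → b * u ^ k = -(s : ℂ) → 0 ≤ R →
      ∀ {z : ℂ}, z ∈ petal k b ζ u R → 2 * R < (fatouCoord k b ζ z).re →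
      ‖fatouCoord k b ζ z‖ ≤ 2 * (fatouCoord k b ζ z).re →
      Metric.ball z (κ * ‖z - ζ‖) ⊆ petal k b ζ u R := by
  have hk0 : (0 : ℝ) < k := by exact_mod_cast hk
  have h1 : ContinuousAt (fun e : ℂ => ((1 + e) ^ k)⁻¹ - 1) 0 :=
    ((by fun_prop : ContinuousAt (fun e : ℂ => (1 + e) ^ k) 0).inv₀ (by simp)).sub_const 1
  have h2 : ContinuousAt (fun e : ℂ => |Complex.arg (1 + e)|) 0 :=
    (ContinuousAt.comp (f := fun e : ℂ => 1 + e) (g := Complex.arg)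
      (Complex.continuousAt_arg (by simp)) (by fun_prop)).abs
  have h3 : ContinuousAt (fun e : ℂ => 1 + e) 0 := by fun_prop
  obtain ⟨κ, hκ, hball⟩ := Metric.mem_nhds_iff.1 (inter_mem
    (inter_mem (h1.norm.eventually_lt_const (u := 1 / 4) (by simp))
      (h2.eventually_lt_const (u := Real.pi / (2 * k)) (by simp; positivity)))
    (h3.eventually_ne (y := 0) (by simp)))
  refine ⟨κ, hκ, fun {u s R} hs hu hbu hR {z} hz h2R hW y hy => ?_⟩
  have hzζ := ne_of_re_fatouCoord_pos hk (hR.trans_lt hz.2)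
  have hv := sub_ne_zero.2 hzζ
  have hvn := norm_pos_iff.2 hv
  have hη : (y - z) / (z - ζ) ∈ Metric.ball (0 : ℂ) κ := by
    rw [mem_ball_zero_iff, norm_div, div_lt_iff₀ hvn]
    exact mem_ball_iff_norm.1 hy
  obtain ⟨⟨e1, e2⟩, e3⟩ := hball hη
  have hyρ : y - ζ = (z - ζ) * (1 + (y - z) / (z - ζ)) := by field_simp; ring
  refine mem_petal_of_mul hk hs hu hbu hR hz hzζ e3 e2 hyρ ?_
  rw [fatouCoord_mul hyρ]
  have e4 : ‖fatouCoord k b ζ z * ((1 + (y - z) / (z - ζ)) ^ k)⁻¹ - fatouCoord k b ζ z‖ ≤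
      ‖fatouCoord k b ζ z‖ * (1 / 4) := by
    rw [← mul_sub_one, norm_mul]
    gcongr
    exact le_of_lt e1
  have e5 := (abs_le.1 ((Complex.abs_re_le_norm _).trans e4)).1
  rw [Complex.sub_re] at e5
  linarith

/-- A univalent solution `Φ` of the Abel equation on a petal satisfies `Φ'' / Φ' ^ 2 = O(1 / n)` along
orbits, by Koebe distortion: the distance of the consecutive points `z`, `g z`, which `Φ` moves to
distance `1`, is `O(‖z - ζ‖ ^ (k + 1))`, while `Φ` is univalent on a disc about `z` of radius
comparable to `‖z - ζ‖`, and `‖z - ζ‖ ^ k` is of size `1 / n` at the `n`-th point. -/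
theorem IsParabolicOn.exists_bound (hg : IsParabolicOn g k b ζ δ) (hs : 0 < s) (hu : u ≠ 0)
    (hbu : b * u ^ k = -(s : ℂ)) (hR : (k * ‖b‖ * δ ^ k)⁻¹ ≤ R) {Φ : ℂ → ℂ}
    (hΦ : DifferentiableOn ℂ Φ (petal k b ζ u R)) (hinj : Set.InjOn Φ (petal k b ζ u R))
    (heq : ∀ z ∈ petal k b ζ u R, Φ (g z) = Φ z + 1) {x₀ : ℂ} (hx₀ : x₀ ∈ petal k b ζ u R) :
    ∃ U ∈ 𝓝 x₀, U ⊆ petal k b ζ u R ∧ ∃ C : ℝ, 0 ≤ C ∧ ∀ᶠ m : ℕ in atTop, ∀ x ∈ U,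
      ‖deriv (deriv Φ) (g^[m] x) / deriv Φ (g^[m] x) ^ 2‖ ≤ C / m := by
  have hδ := hg.pos
  have hk := hg.one_le
  have hk1 : (1 : ℝ) ≤ k := by exact_mod_cast hk
  have hb0 := norm_pos_iff.2 hg.coeff_ne
  have hR0 : 0 ≤ R := le_trans (by positivity) hR
  obtain ⟨κ, hκ, hdisc⟩ := exists_ball_subset_petal hk b ζ
  have hx₀ζ := (hg.near hR hx₀.2).1
  set A := ‖fatouCoord k b ζ x₀‖ + 1 with hA
  have hA0 : 0 ≤ A := by positivity
  refine ⟨petal k b ζ u R ∩ {x | ‖fatouCoord k b ζ x‖ < A}, inter_mem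
    ((isOpen_petal hk hg.coeff_ne hu hR0).mem_nhds hx₀)
    ((continuousAt_fatouCoord hk hg.coeff_ne hx₀ζ).norm.eventually_lt_const (lt_add_one _)),
    Set.inter_subset_left, 32000 / κ, by positivity, ?_⟩
  have hlarge := tendsto_natCast_atTop_atTop (R := ℝ)
  filter_upwards [hlarge.eventually_gt_atTop (12 * A), hlarge.eventually_gt_atTop (4 * R),
    hlarge.eventually_ge_atTop (32000 / κ), eventually_gt_atTop 0] with m hmA hmR hmκ hm0 x hx
  have hm0' : (0 : ℝ) < m := by exact_mod_cast hm0
  have hxA : ‖fatouCoord k b ζ x‖ < A := hx.2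
  have hmem := (hg.mapsTo_petal hs hu hbu hR).iterate m hx.1
  have h1 := hg.norm_iterate_sub_le hs hu hbu hR hx.1 m
  set z := g^[m] x with hz
  set W := fatouCoord k b ζ z with hW
  have hre : m / 2 ≤ W.re := by
    have h2 := hg.lt_re_iterate hs hu hbu hR hx.1 m
    have h3 := (abs_le.1 ((Complex.abs_re_le_norm _).trans hxA.le)).1
    linarith
  have hre' : 3 / 4 * m - A ≤ W.re := by
    have h2 := hg.lt_re_iterate hs hu hbu hR hx.1 m
    have h3 := (abs_le.1 ((Complex.abs_re_le_norm _).trans hxA.le)).1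
    linarith
  have hWle : ‖W‖ ≤ 5 / 4 * m + A := by
    have e : W = (W - fatouCoord k b ζ x - m) + fatouCoord k b ζ x + m := by ring
    rw [e]
    refine norm_add₃_le.trans ?_
    rw [Complex.norm_natCast]
    linarith
  obtain ⟨hzζ, hzδ⟩ := hg.near hR hmem.2
  have hv : 0 < ‖z - ζ‖ := norm_pos_iff.2 (sub_ne_zero.2 hzζ)
  have hsub := hdisc hs hu hbu hR0 hmem (by linarith) (by linarith)
  have hWge : m / 2 ≤ ‖W‖ := hre.trans (Complex.re_le_norm W)
  have hpow : ‖b‖ * ‖z - ζ‖ ^ k ≤ 2 / m := by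
    have h2 : ‖W‖ = (k * ‖b‖ * ‖z - ζ‖ ^ k)⁻¹ := norm_fatouCoord k b ζ z
    rw [h2, le_inv_comm₀ (by positivity) (by positivity)] at hWge
    calc ‖b‖ * ‖z - ζ‖ ^ k ≤ k * (‖b‖ * ‖z - ζ‖ ^ k) := le_mul_of_one_le_left (by positivity) hk1
      _ = k * ‖b‖ * ‖z - ζ‖ ^ k := by ring
      _ ≤ (m / 2 : ℝ)⁻¹ := hWge
      _ = 2 / m := by rw [inv_div]
  have hρd : 8000 * (2 * ‖b‖ * ‖z - ζ‖ ^ (k + 1)) ≤ κ * ‖z - ζ‖ := by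
    calc 8000 * (2 * ‖b‖ * ‖z - ζ‖ ^ (k + 1)) = 16000 * (‖b‖ * ‖z - ζ‖ ^ k) * ‖z - ζ‖ := by ring
      _ ≤ 16000 * (2 / m) * ‖z - ζ‖ := by gcongr
      _ ≤ κ * ‖z - ζ‖ := by
        gcongr
        rw [div_le_iff₀ hκ] at hmκ
        rw [mul_div_assoc', div_le_iff₀ hm0']
        linarith
  have h2 := norm_deriv_deriv_div_sq_le (by positivity) hρd (hΦ.mono hsub) (hinj.mono hsub)
    (hg.norm_sub z hzζ hzδ) (by rw [heq z hmem, add_sub_cancel_left, norm_one])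
  refine h2.trans ?_
  calc 8000 * (2 * ‖b‖ * ‖z - ζ‖ ^ (k + 1)) / (κ * ‖z - ζ‖)
      = 16000 * (‖b‖ * ‖z - ζ‖ ^ k) / κ := by field_simp; ring
    _ ≤ 16000 * (2 / m) / κ := by gcongr
    _ = 32000 / κ / m := by field_simp; norm_num

end

/-! ### The parabolic case -/

/-- The multiplier is the same at all points of a cycle. -/
theorem hasStrictDerivAt_iterate_of_cycle {f : ℂ → ℂ} (hf : MeromorphicNFOn f Set.univ) {p : ℕ}
    {a : ℂ} (ha : a ∉ prePoles f) (hfix : f^[p] a = a) (hlam : deriv f^[p] a = 1) {j : ℕ}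
    (hj : j ≤ p) : HasStrictDerivAt f^[p] 1 (f^[j] a) := by
  have hd := fun n i => (analyticAt_iterate hf (iterate_notMem_prePoles ha i) n).differentiableAt
  have h1 : deriv f^[p] (f^[j] a) * deriv f^[j] a = deriv f^[j] a * 1 := by
    have e : f^[p] ∘ f^[j] = f^[j] ∘ f^[p] := by
      rw [← Function.iterate_add, ← Function.iterate_add, add_comm]
    have h2 := deriv_comp a (hd p j) (hd j 0)
    have h3 := deriv_comp a (h₂ := f^[j]) (h := f^[p]) (by rw [hfix]; exact hd j 0) (hd p 0)
    rw [hfix, hlam] at h3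
    rw [← h2, e, h3]
  have h0 : deriv f^[j] a ≠ 0 := by
    have e : f^[p] = f^[p - j] ∘ f^[j] := by rw [← Function.iterate_add, Nat.sub_add_cancel hj]
    have h2 := deriv_comp a (hd (p - j) j) (hd j 0)
    rw [← e, hlam] at h2
    intro h0
    rw [h0, mul_zero] at h2
    exact one_ne_zero h2
  have h2 : deriv f^[p] (f^[j] a) = 1 := by
    rw [mul_comm] at h1
    exact mul_left_cancel₀ h0 h1
  have h3 := (analyticAt_iterate hf (iterate_notMem_prePoles ha j) p).hasStrictDerivAt
  rwa [h2] at h3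

/-- The leading term of a germ tangent to, but different from, the identity. -/
theorem exists_parabolic_expansion {g : ℂ → ℂ} {ζ : ℂ} (hg : AnalyticAt ℂ g ζ) (hfix : g ζ = ζ)
    (hd : HasDerivAt g 1 ζ) (hid : ¬ ∀ᶠ z in 𝓝 ζ, g z = z) :
    ∃ k : ℕ, 1 ≤ k ∧ ∃ b : ℂ, b ≠ 0 ∧
      (fun z => g z - z - b * (z - ζ) ^ (k + 1)) =o[𝓝 ζ] fun z => (z - ζ) ^ (k + 1) := by
  have hG : AnalyticAt ℂ (fun z => g z - z) ζ := hg.sub analyticAt_id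
  obtain ⟨m, h, hh, hne, heq⟩ := hG.exists_eventuallyEq_pow_smul_nonzero_iff.2
    (fun h => hid (h.mono fun z hz => sub_eq_zero.1 hz))
  simp only [smul_eq_mul] at heq
  have hm0 : m ≠ 0 := by
    rintro rfl
    have := heq.self_of_nhds
    rw [hfix, sub_self, pow_zero, one_mul] at this
    exact hne this.symm
  have hm1 : m ≠ 1 := by
    rintro rfl
    have h1 : HasDerivAt (fun z => g z - z) 0 ζ :=
      (hd.sub (hasDerivAt_id ζ)).congr_deriv (sub_self 1)
    have h2 := ((hasDerivAt_id ζ).sub_const ζ).mul hh.differentiableAt.hasDerivAt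
    have h3 := h1.unique (h2.congr_of_eventuallyEq (by
      filter_upwards [heq] with z hz
      rw [hz, pow_one]; rfl))
    simp at h3
    exact hne h3.symm
  obtain ⟨k, rfl⟩ : ∃ k, m = k + 1 := ⟨m - 1, by omega⟩
  refine ⟨k, by omega, h ζ, hne, ?_⟩
  have h1 : (fun z => h z - h ζ) =o[𝓝 ζ] fun _ => (1 : ℂ) := by
    rw [isLittleO_one_iff]
    simpa using hh.continuousAt.tendsto.sub_const (h ζ)
  have h2 := h1.mul_isBigO (isBigO_refl (fun z => (z - ζ) ^ (k + 1)) (𝓝 ζ))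
  simp only [one_mul] at h2
  refine h2.congr' ?_ EventuallyEq.rfl
  filter_upwards [heq] with z hz
  rw [hz]; ring

theorem abel_iterate {f : ℂ → ℂ} {S : Set ℂ} {Φ : ℂ → ℂ} {e : ℂ} (hS : Set.MapsTo f S S)
    (heq : ∀ z ∈ S, Φ (f z) = Φ z + e) (n : ℕ) {z : ℂ} (hz : z ∈ S) :
    Φ (f^[n] z) = Φ z + n * e := by
  induction n with
  | zero => simp
  | succ n ih =>
    rw [Function.iterate_succ_apply', heq _ (hS.iterate n hz), ih]
    push_cast; ring

/-- The petals constructed in the approximate Fatou coordinate are attracting petals contained in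
the basin. -/
theorem isAttractingPetal_petal {f : ℂ → ℂ} (hf : MeromorphicNFOn f Set.univ) {p : ℕ} (hp : 1 ≤ p)
    {a : ℂ} (ha : a ∉ prePoles f) (hfix : f^[p] a = a) {j : ℕ} (hj : j ≤ p) {k : ℕ} {b u : ℂ}
    {δ s R : ℝ} (hg : IsParabolicOn f^[p] k b (f^[j] a) δ)
    (hδ : Metric.ball (f^[j] a) δ ⊆ {x | ∀ i < p, AnalyticAt ℂ f (f^[i] x)}) (hs : 0 < s)
    (hu : ‖u‖ = 1) (hbu : b * u ^ k = -(s : ℂ)) (hR : (k * ‖b‖ * δ ^ k)⁻¹ ≤ R) :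
    IsAttractingPetal f p (f^[j] a) u (petal k b (f^[j] a) u R) ∧
      petal k b (f^[j] a) u R ⊆ basin f p a := by
  have hu0 : u ≠ 0 := norm_ne_zero_iff.1 (by rw [hu]; exact one_ne_zero)
  have hδ0 := hg.pos
  have hR0 : 0 ≤ R := le_trans (by positivity) hR
  have ho := isOpen_petal (ζ := f^[j] a) hg.one_le hg.coeff_ne hu0 hR0
  have hmaps := hg.mapsTo_petal hs hu0 hbu hR
  have hnear : petal k b (f^[j] a) u R ⊆ Metric.ball (f^[j] a) δ := fun z hz =>
    mem_ball_iff_norm.2 (hg.near hR hz.2).2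
  have hdef : petal k b (f^[j] a) u R ⊆ (prePoles f)ᶜ :=
    subset_compl_prePoles_of_mapsTo hp hmaps fun x hx => hδ (hnear hx)
  refine ⟨⟨ho, hdef, hmaps, hg.injOn.mono hnear, fun z _ => ⟨fun h => ?_, fun h =>
    h.eventually_mem_petal hg.one_le hs hu hbu R⟩⟩,
    subset_basin_of_absorbed hf hp ha hfix hj ho hdef fun V hV => ?_⟩
  · obtain ⟨N, hN⟩ := h.exists
    obtain ⟨h1, h2⟩ := hg.convergesFrom hs hu hbu hR hN
    simp only [Function.iterate_mul, ← Function.iterate_add_apply] at h1 h2 ⊢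
    exact ⟨(tendsto_add_atTop_iff_nat N).1 h1, (tendsto_add_atTop_iff_nat
      (f := fun n => ((f^[p])^[n] z - f^[j] a) / ((‖(f^[p])^[n] z - f^[j] a‖ : ℝ) : ℂ)) N).1 h2⟩
  · simpa only [Function.iterate_mul] using hg.eventually_mem hs hu0 hbu hR hV

section

variable {f : ℂ → ℂ} {p : ℕ} {a : ℂ} {Φ : ℂ → ℂ}

theorem IsAbelSolution.ne_of_mem_basin (hΦ : IsAbelSolution f p a Φ)
    (hf : MeromorphicNFOn f Set.univ) (hp : 1 ≤ p) (hnc : ∀ z c, ¬ ∀ᶠ w in 𝓝 z, f w = c) {z : ℂ}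
    (hz : z ∈ basin f p a) : Φ (f^[p] z) = Φ z + 1 := by
  rw [abel_iterate (fun z hz => map_mem_basin hf hp hnc hz) hΦ.eqn p hz]
  have : (p : ℂ) ≠ 0 := by exact_mod_cast (by omega : p ≠ 0)
  field_simp

/-- The existence of a solution of the Abel equation excludes periodic points of period dividing `p`
from the basin. Hence orbits in the basin that converge to a point of the cycle do not reach it, the
germ of `f^p` there is not the identity, and the orbits enter a petal. -/
theorem IsAbelSolution.exists_petal (hΦ : IsAbelSolution f p a Φ)
    (hf : MeromorphicNFOn f Set.univ) (hp : 1 ≤ p) (ha : a ∉ prePoles f) (hfix : f^[p] a = a)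
    (hlam : deriv f^[p] a = 1) {j : ℕ} (hj : j < p) {z : ℂ} (hz : z ∈ basin f p a)
    (hlim : Tendsto (fun m : ℕ => f^[p * m] z) atTop (𝓝 (f^[j] a))) :
    ∃ (k : ℕ) (b u : ℂ) (δ s R : ℝ) (N : ℕ), IsParabolicOn f^[p] k b (f^[j] a) δ ∧ 0 < s ∧
      ‖u‖ = 1 ∧ b * u ^ k = -(s : ℂ) ∧ (k * ‖b‖ * δ ^ k)⁻¹ ≤ R ∧
      f^[p * N] z ∈ petal k b (f^[j] a) u R ∧ petal k b (f^[j] a) u R ⊆ basin f p a ∧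
      Set.InjOn Φ (petal k b (f^[j] a) u R) := by
  have hnc := not_eventually_const hf hp ha (by rw [hlam]; exact one_ne_zero)
  have hper : ∀ x ∈ basin f p a, f^[p] x ≠ x := by
    intro x hx h
    have h1 := hΦ.ne_of_mem_basin hf hp hnc hx
    rw [h] at h1
    simp at h1
  have hζ := iterate_notMem_prePoles ha j
  have hfixζ : f^[p] (f^[j] a) = f^[j] a := by
    rw [← Function.iterate_add_apply, add_comm, Function.iterate_add_apply, hfix]
  have hstrict := hasStrictDerivAt_iterate_of_cycle hf ha hfix hlam hj.le
  have hid : ¬ ∀ᶠ z in 𝓝 (f^[j] a), f^[p] z = z := by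
    intro h
    obtain ⟨m, hm⟩ := (hlim.eventually h).exists
    exact hper _ (iterate_mem_basin hf hp hnc hz _) hm
  obtain ⟨k, hk, b, hb, hexp⟩ := exists_parabolic_expansion (analyticAt_iterate hf hζ p) hfixζ
    hstrict.hasDerivAt hid
  obtain ⟨δ, hg, hδ⟩ := exists_isParabolicOn hk hb hexp hstrict
    (eventually_analyticAt_orbit hf hζ p)
  have hδ0 := hg.pos
  obtain ⟨N, u, hu, ⟨s, hs, hbu⟩, hmem⟩ := hg.exists_mem_petal (R := (k * ‖b‖ * δ ^ k)⁻¹) (z := z)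
    (by positivity) (fun n h => by
      rw [← Function.iterate_mul] at h
      have h1 := iterate_mem_basin hf hp hnc hz (p * n)
      rw [h] at h1
      exact hper _ h1 hfixζ) (by simpa only [Function.iterate_mul] using hlim)
  obtain ⟨hpet, hbas⟩ := isAttractingPetal_petal hf hp ha hfix hj.le hg hδ hs hu hbu le_rfl
  refine ⟨k, b, u, δ, s, _, N, hg, hs, hu, hbu, le_rfl, ?_, hbas,
    hΦ.injOn j hj u ⟨hu, k, hk, b, hexp, s, hs, hbu⟩ _ hpet⟩
  rwa [Function.iterate_mul]

theorem IsAbelSolution.isOpen_basin (hΦ : IsAbelSolution f p a Φ)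
    (hf : MeromorphicNFOn f Set.univ) (hp : 1 ≤ p) (ha : a ∉ prePoles f) (hfix : f^[p] a = a)
    (hlam : deriv f^[p] a = 1) : IsOpen (basin f p a) := by
  have hnc := not_eventually_const hf hp ha (by rw [hlam]; exact one_ne_zero)
  refine isOpen_basin_of_nhds hf fun z hz => ?_
  obtain ⟨j, hj⟩ := hz.2
  have hlim : Tendsto (fun m : ℕ => f^[p * m] (f^[j] z)) atTop (𝓝 (f^[0] a)) := by
    simpa only [← Function.iterate_add_apply] using! hj
  obtain ⟨k, b, u, δ, s, R, N, hg, hs, hu, hbu, hR, hmem, -, -⟩ :=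
    hΦ.exists_petal hf hp ha hfix hlam hp (iterate_mem_basin hf hp hnc hz j) hlim
  have hu0 : u ≠ 0 := norm_ne_zero_iff.1 (by rw [hu]; exact one_ne_zero)
  have hδ0 := hg.pos
  refine ⟨_, p * N + j, isOpen_petal hg.one_le hg.coeff_ne hu0 (le_trans (by positivity) hR),
    by rwa [Function.iterate_add_apply], fun x hx => ?_⟩
  simpa only [Function.iterate_mul] using! hg.tendsto_iterate hs hu0 hbu hR hx

/-- The bound for `Φ'' / Φ' ^ 2` along the iterates in one residue class mod `p`. -/
theorem IsAbelSolution.exists_bound (hΦ : IsAbelSolution f p a Φ)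
    (hf : MeromorphicNFOn f Set.univ) (hp : 1 ≤ p) (ha : a ∉ prePoles f) (hfix : f^[p] a = a)
    (hlam : deriv f^[p] a = 1) {j i : ℕ} (hj : j < p) {z : ℂ} (hz : z ∈ basin f p a)
    (hlim : Tendsto (fun m : ℕ => f^[i + p * m] z) atTop (𝓝 (f^[j] a))) :
    ∃ U ∈ 𝓝 z, ∃ C : ℝ, 0 ≤ C ∧ ∀ᶠ l : ℕ in atTop, ∀ w ∈ U,
      ‖deriv (deriv Φ) (f^[i + p * l] w) / deriv Φ (f^[i + p * l] w) ^ 2‖ ≤ C / l := by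
  have hnc := not_eventually_const hf hp ha (by rw [hlam]; exact one_ne_zero)
  obtain ⟨k, b, u, δ, s, R, N, hg, hs, hu, hbu, hR, hmem, hbas, hinj⟩ :=
    hΦ.exists_petal hf hp ha hfix hlam hj (iterate_mem_basin hf hp hnc hz i)
      (by simpa only [add_comm i, Function.iterate_add_apply] using hlim)
  have hu0 : u ≠ 0 := norm_ne_zero_iff.1 (by rw [hu]; exact one_ne_zero)
  obtain ⟨V, hV, -, C, hC, h⟩ := hg.exists_bound hs hu0 hbu hR (hΦ.holo.mono hbas) hinj
    (fun x hx => hΦ.ne_of_mem_basin hf hp hnc (hbas hx)) hmem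
  rw [← Function.iterate_add_apply] at hV
  have hcont := (analyticAt_iterate hf (notMem_prePoles_of_mem_fatouSet hz.1) (p * N + i)).continuousAt
  refine ⟨_, hcont hV, 2 * C, by positivity, ?_⟩
  obtain ⟨M, hM⟩ := eventually_atTop.1 h
  filter_upwards [eventually_ge_atTop (2 * N + M + 1)] with l hl w hw
  have h1 := hM (l - N) (by omega) _ hw
  have e : p * (l - N) + (p * N + i) = i + p * l := by
    rw [← add_assoc, ← mul_add, Nat.sub_add_cancel (by omega), add_comm]
  rw [← Function.iterate_mul, ← Function.iterate_add_apply, e] at h1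
  refine h1.trans ?_
  have hl0 : (0 : ℝ) < l := by exact_mod_cast (by omega : 0 < l)
  have hlN : (l : ℝ) ≤ 2 * ((l - N : ℕ) : ℝ) := by exact_mod_cast (by omega : l ≤ 2 * (l - N))
  rw [div_le_div_iff₀ (by linarith) hl0]
  nlinarith

/-- Bounds `O(1 / l)` along all residue classes mod `p` combine to a bound `O(1 / n)`. -/
theorem exists_bound_of_residues {Q : ℕ → ℂ → ℝ} {p : ℕ} (hp : 1 ≤ p) {z : ℂ} (j : ℕ)
    (h : ∀ i < p, ∃ U ∈ 𝓝 z, ∃ C : ℝ, 0 ≤ C ∧ ∀ᶠ l : ℕ in atTop, ∀ w ∈ U,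
      Q (j + i + p * l) w ≤ C / l) :
    ∃ U ∈ 𝓝 z, ∃ C : ℝ, ∀ᶠ n : ℕ in atTop, ∀ w ∈ U, Q n w ≤ C * (1 / (n : ℝ)) := by
  choose! U hU C hC h using h
  have hall : ∀ᶠ l : ℕ in atTop, ∀ i ∈ Finset.range p, ∀ w ∈ U i,
      Q (j + i + p * l) w ≤ C i / l :=
    (Finset.eventually_all _).2 fun i hi => h i (Finset.mem_range.1 hi)
  obtain ⟨M, hM⟩ := eventually_atTop.1 hall
  refine ⟨⋂ i ∈ Finset.range p, U i, (Filter.biInter_finset_mem _).2 fun i hi =>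
    hU i (Finset.mem_range.1 hi), (∑ i ∈ Finset.range p, C i) * (2 * p), ?_⟩
  filter_upwards [eventually_ge_atTop (2 * (j + p) + p * M + 1)] with n hn w hw
  have hi : (n - j) % p ∈ Finset.range p := Finset.mem_range.2 (Nat.mod_lt _ hp)
  have hdm := Nat.mod_add_div (n - j) p
  have hlt := Nat.mod_lt (n - j) hp
  have hM' : M ≤ (n - j) / p := (Nat.le_div_iff_mul_le hp).2 (by rw [mul_comm]; omega)
  have h1 := hM _ hM' _ hi w (Set.mem_iInter₂.1 hw _ hi)
  rw [add_assoc, hdm, Nat.add_sub_cancel' (by omega)] at h1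
  refine h1.trans ?_
  have h2 : C ((n - j) % p) ≤ ∑ i ∈ Finset.range p, C i :=
    Finset.single_le_sum (fun i hi => hC i (Finset.mem_range.1 hi)) hi
  have hn0 : (0 : ℝ) < n := by exact_mod_cast (by omega : 0 < n)
  have h3 : (n : ℝ) ≤ 2 * p * (((n - j) / p : ℕ) : ℝ) := by
    have : n ≤ 2 * (p * ((n - j) / p)) := by omega
    rw [mul_assoc]
    exact_mod_cast this
  have h4 : (0 : ℝ) < (((n - j) / p : ℕ) : ℝ) := by
    by_contra! hcon
    have : (0 : ℝ) ≤ 2 * p := by positivity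
    nlinarith
  have h5 := hC _ (Finset.mem_range.1 hi)
  rw [mul_one_div, div_le_div_iff₀ h4 hn0]
  calc C ((n - j) % p) * n ≤ C ((n - j) % p) * (2 * p * (((n - j) / p : ℕ) : ℝ)) := by gcongr
    _ ≤ (∑ i ∈ Finset.range p, C i) * (2 * p * (((n - j) / p : ℕ) : ℝ)) := by gcongr
    _ = _ := by ring

theorem derivQuotientApprox_of_parabolic (hf : MeromorphicNFOn f Set.univ) (hp : 1 ≤ p)
    (ha : a ∉ prePoles f) (hfix : f^[p] a = a) (hlam : deriv f^[p] a = 1)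
    (hΦ : IsAbelSolution f p a Φ) {t : ℕ} (ht : 1 ≤ t) :
    DerivQuotientApprox f Φ t (fun n => 1 / (n : ℝ)) (basin f p a \ {z | deriv Φ z = 0}) := by
  have hnc := not_eventually_const hf hp ha (by rw [hlam]; exact one_ne_zero)
  refine derivQuotientApprox_of_bound hf hp hnc (hΦ.isOpen_basin hf hp ha hfix hlam) hΦ.holo
    one_ne_zero (e := 1 / (p : ℂ)) (fun z hz => by rw [hΦ.eqn z hz, one_mul])
    (fun n => by positivity) (fun n => ?_) (fun z hz => ?_) ht
  · rcases n.eq_zero_or_pos with rfl | hn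
    · simp
    · rw [div_le_one (by exact_mod_cast hn)]
      exact_mod_cast hn
  · simp only [norm_one, one_pow, mul_one]
    obtain ⟨j, hj⟩ := hz.2
    refine exists_bound_of_residues
      (Q := fun n w => ‖deriv (deriv Φ) (f^[n] w) / deriv Φ (f^[n] w) ^ 2‖) hp j fun i hi => ?_
    refine hΦ.exists_bound hf hp ha hfix hlam hi hz ?_
    refine ((analyticAt_iterate hf ha i).continuousAt.tendsto.comp hj).congr fun m => ?_
    rw [Function.comp_apply, ← Function.iterate_add_apply]
    congr 1
    ring_nf

end

theorem theorem2 (f : ℂ → ℂ) (hf : MeromorphicNFOn f Set.univ)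
    (p : ℕ) (hp : 1 ≤ p) (a : ℂ) (ha : a ∉ prePoles f) (hfix : f^[p] a = a)
    (lam : ℂ) (hlam : lam = deriv (f^[p]) a) (Φ : ℂ → ℂ) (t : ℕ) (ht : 2 ≤ t) :
    (lam ≠ 0 → ‖lam‖ < 1 → ∀ c : ℂ, IsSchroederSolution f p a c Φ →
      DerivQuotientApprox f Φ t (fun n => ‖lam‖ ^ ((n : ℝ) / (p : ℝ)))
        (basin f p a \ {z | deriv Φ z = 0})) ∧
    (lam = 1 → IsAbelSolution f p a Φ →
      DerivQuotientApprox f Φ t (fun n => 1 / (n : ℝ))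
        (basin f p a \ {z | deriv Φ z = 0})) := by
  subst hlam
  exact ⟨fun h0 h1 c hΦ => derivQuotientApprox_of_attracting hf hp ha hfix h0 h1 hΦ (by omega),
    fun h1 hΦ => derivQuotientApprox_of_parabolic hf hp ha hfix h1 hΦ (by omega)⟩
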